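/- Let $u:\mathbb R\to\mathbb R$ be a real-valued Schwartz function. Write $\hat f(\xi)=\int_{\mathbb R}e^{-i\xi x}f(x)\,dx$ and let $C_+$ be the Cauchy projection, $\widehat{C_+f}=\chi_{(0,\infty)}\hat f$. For $k\in\mathbb C\setminus[0,\infty)$ and $\lambda>0$ put (the integrals converging conditionally for $x\ne0$) $$G_k(x)=\frac1{2\pi}\int_0^\infty\frac{e^{ix\xi}}{\xi-k}\,d\xi,\qquad G_{\lambda\pm0i}(x)=\lim_{\varepsilon\searrow0}G_{\lambda\pm i\varepsilon}(x)=\pm i e^{i\lambda x}\chi_{\mathbb R^\pm}(x)-\frac1{2\pi}\int_{-\infty}^0\frac{e^{ix\xi}}{\xi-\lambda}\,d\xi .$$ For $k\in(\mathbb C\setminus[0,\infty))\cup(\mathbb R^+\pm0i)$ (with $|\lambda\pm0i|=\lambda$, and $1/k=1/\lambda$ if $k=\lambda\pm0i$) the Jost functions $m_1(\cdot,k)$ and $m_e(\cdot,\lambda+0i)$ are the solutions of $$m_1=1+G_k*(u\,m_1),\qquad m_e=e^{i\lambda x}+G_{\lambda+0i}*(u\,m_e)$$ in the class of measurable functions $m$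 such that $(1+|x|)^{-\sigma}m\in L^\infty(\mathbb R)$ for some $\sigma>0$. When these exist, put $$\Gamma(\lambda)=1+i\int_{\mathbb R}u(x)m_e(x,\lambda+0i)e^{-i\lambda x}\,dx,\qquad \beta(\lambda)=i\int_{\mathbb R}u(x)m_1(x,\lambda+0i)e^{-i\lambda x}\,dx .$$ Then there exist $k_0>0$ and $C>0$ (depending on $u$) such that, for every $k\in(\mathbb C\setminus[0,\infty))\cup(\mathbb R^+\pm0i)$ with $|k|>k_0$, the Jost function $m_1(\cdot,k)$ exists and is unique (up to equality almost everywhere), and $$\Big\|m_1(x,k)-1+\frac{C_+u(x)}k\Big\|_{L^\infty_x(\mathbb R)}\le\frac C{|k|^2};$$ for every $\lambda>k_0$ the Jost function $m_e(\cdot,\lambda+0i)$ exists and is unique; and for every positive integer $N$ there exists $C_N>0$ such that, for all $\lambda>k_0$, $$\Big\|m_e(x,\lambda+0i)-e^{i\lambda x}e^{i\int_{-\infty}^xu(t)\,dt}\Big\|_{L^\infty_x(\mathbb R)}\le\frac{C_N}{\lambda^N},\qquad \Big|\Gamma(\lambda)-e^{i\int_{\mathbb R}u(t)\,dt}\Big|\le\frac{C_N}{\lambda^N},\qquad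 |\beta(\lambda)|\le\frac{C_N}{\lambda^N}.$$ -/

import Mathlib

open MeasureTheory Filter Topology Complex
open scoped SchwartzMap ENNReal

namespace BenjaminOno

/-- The Fourier transform with the convention `f̂(ξ) = ∫ e^{-iξx} f(x) dx`. -/
noncomputable def hat (f : ℝ → ℂ) (ξ : ℝ) : ℂ :=
  ∫ x : ℝ, cexp (-(I * ξ * x)) * f x

/-- The Cauchy projection `C₊`, the Fourier multiplier with symbol `χ_{(0,∞)}`:
`C₊f(x) = (1/2π) ∫_0^∞ e^{ixξ} f̂(ξ) dξ`. For a Schwartz function `f` the integral converges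
absolutely. -/
noncomputable def cauchyPlus (f : ℝ → ℂ) (x : ℝ) : ℂ :=
  1 / (2 * Real.pi) * ∫ ξ in Set.Ioi (0 : ℝ), cexp (I * x * ξ) * hat f ξ

/-- The kernel `G_k(x) = (1/2π) ∫_0^∞ e^{ixξ}/(ξ - k) dξ` for `k ∉ [0,∞)`. The integral is only
conditionally convergent, so it is the limit of `∫_0^R` as `R → ∞`. This limit exists for
every `x ≠ 0`; the value at `x = 0` plays no role. -/
noncomputable def kernelG (k : ℂ) (x : ℝ) : ℂ :=
  1 / (2 * Real.pi) *
    limUnder atTop (fun R : ℝ => ∫ ξ in (0 : ℝ)..R, cexp (I * x * ξ) / ((ξ : ℂ) - k))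

/-- The kernel `G̃_k(x) = (1/2π) ∫_{-∞}^0 e^{ixξ}/(ξ - k) dξ` for `k ∉ (-∞,0]`, again as a
conditionally convergent integral (convergent for every `x ≠ 0`). -/
noncomputable def kernelGTilde (k : ℂ) (x : ℝ) : ℂ :=
  1 / (2 * Real.pi) *
    limUnder atTop (fun R : ℝ => ∫ ξ in (-R)..(0 : ℝ), cexp (I * x * ξ) / ((ξ : ℂ) - k))

/-- The plane wave `e(x, l) = e^{ilx}`. -/
noncomputable def planeWave (l : ℝ) (x : ℝ) : ℂ := cexp (I * l * x)

/-- The boundary kernel `G_{l+0i} = i e^{ilx} χ_{(0,∞)}(x) - G̃_l(x)`, for `l > 0`: the limit of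
`G_{l+iε}` as `ε ↓ 0`. -/
noncomputable def kernelAbove (l : ℝ) (x : ℝ) : ℂ :=
  Set.indicator (Set.Ioi (0 : ℝ)) (fun y => I * planeWave l y) x - kernelGTilde l x

/-- The boundary kernel `G_{l-0i} = -i e^{ilx} χ_{(-∞,0)}(x) - G̃_l(x)`, for `l > 0`: the limit of
`G_{l-iε}` as `ε ↓ 0`. -/
noncomputable def kernelBelow (l : ℝ) (x : ℝ) : ℂ :=
  Set.indicator (Set.Iio (0 : ℝ)) (fun y => -I * planeWave l y) x - kernelGTilde l x

/-- The set `(ℂ ∖ [0,∞)) ∪ (ℝ⁺ ± 0i)`: the plane cut along `[0,∞)`, with the two sides `l + 0i`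
and `l - 0i` of the open half-line glued in. -/
inductive CutPlane : Type
  | interior (k : ℂ) (hk : ∀ t : ℝ, 0 ≤ t → k ≠ (t : ℂ)) : CutPlane
  | above (l : ℝ) (hl : 0 < l) : CutPlane
  | below (l : ℝ) (hl : 0 < l) : CutPlane

/-- The complex number underlying a point of the cut plane (`l` for `l ± 0i`). -/
def CutPlane.val : CutPlane → ℂ
  | .interior k _ => k
  | .above l _ => (l : ℂ)
  | .below l _ => (l : ℂ)

/-- The kernel `G_k` for `k ∈ (ℂ ∖ [0,∞)) ∪ (ℝ⁺ ± 0i)`. -/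
noncomputable def CutPlane.kernel : CutPlane → ℝ → ℂ
  | .interior k _ => kernelG k
  | .above l _ => kernelAbove l
  | .below l _ => kernelBelow l

/-- `m` belongs to the weighted space `L^∞_{-σ}(ℝ)`: with `w(x) = 1 + |x|`, the function
`w^{-σ} m` is (measurable and) essentially bounded. -/
def MemWeightedLInfty (σ : ℝ) (m : ℝ → ℂ) : Prop :=
  MemLp (fun x : ℝ => (((1 + |x|) ^ (-σ) : ℝ) : ℂ) * m x) ∞ volume

/-- `m` solves the Fredholm equation `m = g + G * (u m)` almost everywhere, and lies in
`L^∞_{-σ}(ℝ)` for some `σ > 0`. -/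
def IsJostSolution (u : 𝓢(ℝ, ℝ)) (G g m : ℝ → ℂ) : Prop :=
  (∃ σ : ℝ, 0 < σ ∧ MemWeightedLInfty σ m) ∧
    ∀ᵐ x : ℝ, m x = g x + ∫ y : ℝ, G (x - y) * ((u y : ℂ) * m y)

/-- The Fredholm equation `m = g + G * (u m)` has exactly one solution, up to equality almost
everywhere. -/
def HasUniqueJostSolution (u : 𝓢(ℝ, ℝ)) (G g : ℝ → ℂ) : Prop :=
  ∃ m, IsJostSolution u G g m ∧ ∀ m', IsJostSolution u G g m' → m' =ᵐ[volume] m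

open scoped Classical in
/-- A solution of `m = g + G * (u m)` (and `0` if there is none). -/
noncomputable def jostSolution (u : 𝓢(ℝ, ℝ)) (G g : ℝ → ℂ) : ℝ → ℂ :=
  if h : ∃ m, IsJostSolution u G g m then h.choose else 0

/-- The Jost function `m₁(·, k)`, solving `m₁ = 1 + G_k * (u m₁)`. -/
noncomputable def m₁ (u : 𝓢(ℝ, ℝ)) (k : CutPlane) : ℝ → ℂ :=
  jostSolution u k.kernel (fun _ => 1)

/-- The Jost function `m_e(·, l + 0i)`, solving `m_e = e(l) + G_{l+0i} * (u m_e)`. -/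
noncomputable def mePlus (u : 𝓢(ℝ, ℝ)) (l : ℝ) : ℝ → ℂ :=
  jostSolution u (kernelAbove l) (planeWave l)

/-- The Jost function `m₁(·, l + 0i)`. -/
noncomputable def m₁Plus (u : 𝓢(ℝ, ℝ)) (l : ℝ) : ℝ → ℂ :=
  jostSolution u (kernelAbove l) (fun _ => 1)

/-- The scattering coefficient `Γ(l) = 1 + i ∫ u(x) m_e(x, l + 0i) e^{-ilx} dx`. -/
noncomputable def scatteringΓ (u : 𝓢(ℝ, ℝ)) (l : ℝ) : ℂ :=
  1 + I * ∫ x : ℝ, (u x : ℂ) * mePlus u l x * cexp (-(I * l * x))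

/-- The scattering coefficient `β(l) = i ∫ u(x) m₁(x, l + 0i) e^{-ilx} dx`. -/
noncomputable def scatteringβ (u : 𝓢(ℝ, ℝ)) (l : ℝ) : ℂ :=
  I * ∫ x : ℝ, (u x : ℂ) * m₁Plus u l x * cexp (-(I * l * x))

/-- `m₁Plus` is the value of `m₁` on the upper side of the cut. -/
theorem m₁_above (u : 𝓢(ℝ, ℝ)) (l : ℝ) (hl : 0 < l) : m₁ u (.above l hl) = m₁Plus u l := rfl

end BenjaminOno

/-! The kernel `G_k` does not become small as `|k| → ∞` near the positive half-line, and the proof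
isolates the part that does not. For `Re k > 0` the pole is reflected: `G_k(x)` is a one-sided
exponential `±i e^{ikx} χ_{ℝ^±}(x)`, of modulus at most 1, plus `G_{-k}(-x)`, whose pole `-k` has
distance at least `(ξ + |k|) / 2` from every `ξ ≥ 0`. One integration by parts bounds the latter by
`20 (|k| |x|)^{-1/2}`. For `Re k ≤ 0` no one-sided part is needed. This splitting
(`CutPlane.exists_isSplit`) is uniform up to and on both sides of the cut.

Convolving the one-sided part with `u m` is a Volterra operator: in `L^∞` with the weight `exp(2
∫_{-∞}^x |u|)`, or its mirror image, it has norm at most 1/2 for every `k`. The other part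
contributes `O(|k|^{-1/2})`. For large `|k|` the equation is therefore a contraction with constant
3/4. This yields existence, uniqueness and the stability bound `IsJostSolution.norm_le`: a solution
with datum `g` is at most `4 e^{2‖u‖₁} ‖g‖_∞`. An approximate solution is thus as close to the Jost
function, up to a constant, as its datum is to the true datum.

For `m₁`, put `D = -i d/dx`. Then `G_k * Df = k G_k * f + C₊f` (`CutPlane.integral_kernel_mul_opD`).
Solving for `G_k * f` and iterating, one finds sums `1 + Σ_{j<n} k^{-j-1} C₊f_j`, with `f_j`
Schwartz and independent of `k`, that solve the equation with datum `1 + k^{-n} G_k * f_n`. Order 2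
gives the asymptotics of `m₁`. Moreover `u` times such a sum is Schwartz, so its pairing with
`e^{-iλx}` is a Fourier transform at `λ`, and `β` decays rapidly.

For `m_e`, the function `e^{iλx} e^{i∫_{-∞}^x u}` exactly solves the equation in which only the
one-sided part of the kernel is kept. The other part sees only frequencies `ξ ≤ 0`, where the
transform of `u e^{iλx} e^{i∫u}` is that of a fixed Schwartz function at `ξ - λ ≤ -λ`; the error is
`O(λ^{-N})`. Inserting this in `Γ` leaves the integral of an exact derivative. -/

namespace BenjaminOno

/-! ### The kernel `G_k` off the cut: convergence and size -/

/-- The point `k` keeps the distance `c (ξ + κ)` from every `ξ ≥ 0`. -/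
structure AwayFromCut (k : ℂ) (c κ : ℝ) : Prop where
  c_pos : 0 < c
  κ_pos : 0 < κ
  le_norm : ∀ ξ : ℝ, 0 ≤ ξ → c * (ξ + κ) ≤ ‖(ξ : ℂ) - k‖

/-- The truncated integral in the definition of `kernelG`. -/
noncomputable def truncG (k : ℂ) (R x : ℝ) : ℂ :=
  ∫ ξ in (0 : ℝ)..R, cexp (I * x * ξ) / ((ξ : ℂ) - k)

/-- The absolutely convergent integrand obtained from that of `kernelG` by parts. -/
noncomputable def partsIntegrand (k : ℂ) (x ξ : ℝ) : ℂ :=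
  (cexp (I * x * ξ) - 1) / (I * x * ((ξ : ℂ) - k) ^ 2)

/-- An integrable majorant on `(0, ∞)` with explicit primitive. -/
noncomputable def majorant (κ ξ : ℝ) : ℝ := ((ξ + κ) * √(ξ + κ))⁻¹

theorem norm_cexp_I_mul_mul (x ξ : ℝ) : ‖cexp (I * x * ξ)‖ = 1 := by
  rw [show I * (x : ℂ) * ξ = ((x * ξ : ℝ) : ℂ) * I by push_cast; ring]
  exact norm_exp_ofReal_mul_I _

/-- Interpolates between the bounds `|x ξ|` and 2. After division by `|x|` this leaves the locally
integrable singularity `|x|^{-1/2}`, at the cost of a half power of `ξ`, which the quadratic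
denominator of `partsIntegrand` absorbs. -/
theorem norm_cexp_sub_one_le (x ξ : ℝ) : ‖cexp (I * x * ξ) - 1‖ ≤ 2 * √(|x| * |ξ|) := by
  have h1 : ‖cexp (I * x * ξ) - 1‖ ≤ |x| * |ξ| := by
    have := Real.norm_exp_I_mul_ofReal_sub_one_le (x := x * ξ)
    rw [Real.norm_eq_abs, abs_mul] at this
    rwa [show I * (x : ℂ) * ξ = I * ((x * ξ : ℝ) : ℂ) by push_cast; ring]
  have h2 : ‖cexp (I * x * ξ) - 1‖ ≤ 2 := by
    calc _ ≤ ‖cexp (I * x * ξ)‖ + ‖(1 : ℂ)‖ := norm_sub_le _ _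
      _ = 2 := by rw [norm_cexp_I_mul_mul]; norm_num
  set s := √(|x| * |ξ|)
  have hs : s ^ 2 = |x| * |ξ| := Real.sq_sqrt (by positivity)
  have hs0 : 0 ≤ s := Real.sqrt_nonneg _
  rcases le_total s 1 with h | h
  · nlinarith
  · linarith

theorem hasDerivAt_cexp_I_mul (x ξ : ℝ) :
    HasDerivAt (fun t : ℝ => cexp (I * x * t)) (I * x * cexp (I * x * ξ)) ξ := by
  have h : HasDerivAt (fun t : ℝ => I * (x : ℂ) * (t : ℂ)) (I * x) ξ := by
    simpa using (HasDerivAt.ofReal_comp (hasDerivAt_id ξ)).const_mul (I * (x : ℂ))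
  simpa [mul_comm] using h.cexp

theorem majorant_nonneg {κ ξ : ℝ} (hκ : 0 < κ) (hξ : 0 ≤ ξ) : 0 ≤ majorant κ ξ := by
  unfold majorant; positivity

theorem hasDerivAt_majorant_primitive {κ ξ : ℝ} (h : 0 < ξ + κ) :
    HasDerivAt (fun t => -2 * (√(t + κ))⁻¹) (majorant κ ξ) ξ := by
  have h1 : HasDerivAt (fun t : ℝ => √(t + κ)) (1 / (2 * √(ξ + κ))) ξ :=
    ((hasDerivAt_id ξ).add_const κ).sqrt h.ne'
  have hs : √(ξ + κ) ≠ 0 := (Real.sqrt_pos.2 h).ne'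
  refine ((h1.inv hs).const_mul (-2 : ℝ)).congr_deriv ?_
  unfold majorant
  rw [Real.sq_sqrt h.le]
  field_simp

theorem tendsto_majorant_primitive (κ : ℝ) :
    Tendsto (fun t => -2 * (√(t + κ))⁻¹) atTop (𝓝 0) := by
  have h : Tendsto (fun t : ℝ => √(t + κ)) atTop atTop :=
    Real.tendsto_sqrt_atTop.comp (tendsto_atTop_add_const_right _ _ tendsto_id)
  simpa using h.inv_tendsto_atTop.const_mul (-2 : ℝ)

theorem integrableOn_majorant {κ : ℝ} (hκ : 0 < κ) : IntegrableOn (majorant κ) (Set.Ioi 0) :=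
  integrableOn_Ioi_deriv_of_nonneg'
    (fun ξ hξ => hasDerivAt_majorant_primitive (by linarith [Set.mem_Ici.1 hξ]))
    (fun _ hξ => majorant_nonneg hκ (le_of_lt hξ)) (tendsto_majorant_primitive κ)

theorem integral_majorant {κ : ℝ} (hκ : 0 < κ) :
    ∫ ξ in Set.Ioi (0 : ℝ), majorant κ ξ = 2 * (√κ)⁻¹ := by
  rw [integral_Ioi_of_hasDerivAt_of_tendsto'
    (fun ξ hξ => hasDerivAt_majorant_primitive (by linarith [Set.mem_Ici.1 hξ]))
    (integrableOn_majorant hκ) (tendsto_majorant_primitive κ)]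
  simp

namespace AwayFromCut

variable {k : ℂ} {c κ : ℝ} (hk : AwayFromCut k c κ)

include hk

theorem norm_pos {ξ : ℝ} (hξ : 0 ≤ ξ) : 0 < ‖(ξ : ℂ) - k‖ :=
  lt_of_lt_of_le (mul_pos hk.c_pos (by linarith [hk.κ_pos])) (hk.le_norm ξ hξ)

theorem sub_ne_zero {ξ : ℝ} (hξ : 0 ≤ ξ) : (ξ : ℂ) - k ≠ 0 := norm_pos_iff.1 (hk.norm_pos hξ)

/-- Integration by parts with the primitive `(e^{ixξ} - 1) / (ix)`, normalised to vanish at `ξ = 0`: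
there is no boundary term at the origin, and both remaining terms are controlled by
`norm_cexp_sub_one_le`. -/
theorem truncG_eq {x R : ℝ} (hx : x ≠ 0) (hR : 0 ≤ R) :
    truncG k R x = (cexp (I * x * R) - 1) / (I * x * ((R : ℂ) - k)) +
      ∫ ξ in (0 : ℝ)..R, partsIntegrand k x ξ := by
  have hx' : (x : ℂ) ≠ 0 := by exact_mod_cast hx
  have hmem : ∀ ξ ∈ Set.uIcc 0 R, (ξ : ℂ) - k ≠ 0 := fun ξ hξ => by
    rw [Set.uIcc_of_le hR] at hξ; exact hk.sub_ne_zero hξ.1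
  have hc1 : ContinuousOn (fun ξ : ℝ => cexp (I * x * ξ) / ((ξ : ℂ) - k)) (Set.uIcc 0 R) :=
    ContinuousOn.div (by fun_prop) (by fun_prop) hmem
  have hc2 : ContinuousOn (partsIntegrand k x) (Set.uIcc 0 R) := by
    unfold partsIntegrand
    refine ContinuousOn.div (by fun_prop) (by fun_prop) fun ξ hξ => ?_
    exact mul_ne_zero (mul_ne_zero I_ne_zero hx') (pow_ne_zero _ (hmem ξ hξ))
  have hd : ∀ ξ ∈ Set.uIcc 0 R,
      HasDerivAt (fun t : ℝ => (cexp (I * x * t) - 1) / (I * x * ((t : ℂ) - k)))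
        (cexp (I * x * ξ) / ((ξ : ℂ) - k) - partsIntegrand k x ξ) ξ := by
    intro ξ hξ
    have h0 := hmem ξ hξ
    have h1 := (hasDerivAt_cexp_I_mul x ξ).sub_const 1
    have h2 : HasDerivAt (fun t : ℝ => I * (x : ℂ) * ((t : ℂ) - k)) (I * x) ξ := by
      simpa using ((HasDerivAt.ofReal_comp (hasDerivAt_id ξ)).sub_const k).const_mul (I * (x : ℂ))
    refine (h1.div h2 (mul_ne_zero (mul_ne_zero I_ne_zero hx') h0)).congr_deriv ?_
    unfold partsIntegrand
    have := I_ne_zero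
    field_simp
  have := intervalIntegral.integral_eq_sub_of_hasDerivAt hd
    (hc1.intervalIntegrable.sub hc2.intervalIntegrable)
  rw [intervalIntegral.integral_sub hc1.intervalIntegrable hc2.intervalIntegrable] at this
  simp only [ofReal_zero, mul_zero, Complex.exp_zero, sub_self, zero_div, sub_zero] at this
  rw [← this, truncG]; ring

theorem norm_partsIntegrand_le {x ξ : ℝ} (hx : x ≠ 0) (hξ : 0 ≤ ξ) :
    ‖partsIntegrand k x ξ‖ ≤ 2 / c ^ 2 * (√|x|)⁻¹ * majorant κ ξ := by
  have hc := hk.c_pos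
  have hκ := hk.κ_pos
  have hs : 0 < √|x| := Real.sqrt_pos.2 (abs_pos.2 hx)
  have hp : 0 < ξ + κ := by linarith
  have hn := hk.le_norm ξ hξ
  have h1 := norm_cexp_sub_one_le x ξ
  rw [abs_of_nonneg hξ, Real.sqrt_mul (abs_nonneg x)] at h1
  have h2 : √ξ ≤ √(ξ + κ) := Real.sqrt_le_sqrt (by linarith)
  have hsp : 0 < √(ξ + κ) := Real.sqrt_pos.2 hp
  unfold partsIntegrand majorant
  rw [norm_div, norm_mul, norm_mul, norm_I, one_mul, norm_pow, norm_real, Real.norm_eq_abs]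
  calc _ ≤ (2 * (√|x| * √(ξ + κ))) / (|x| * (c * (ξ + κ)) ^ 2) := by
        have := abs_pos.2 hx
        gcongr
        exact h1.trans (by gcongr)
    _ = _ := by
        have e1 : |x| = √|x| ^ 2 := (Real.sq_sqrt (abs_nonneg x)).symm
        have e2 : ξ + κ = √(ξ + κ) ^ 2 := (Real.sq_sqrt hp.le).symm
        generalize √|x| = s at *
        generalize √(ξ + κ) = t at *
        rw [e1, e2]
        field_simp

theorem norm_boundary_le {x R : ℝ} (hx : x ≠ 0) (hR : 0 ≤ R) :
    ‖(cexp (I * x * R) - 1) / (I * x * ((R : ℂ) - k))‖ ≤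
      2 / c * (√|x|)⁻¹ * (√R * (R + κ)⁻¹) := by
  have hc := hk.c_pos
  have hκ := hk.κ_pos
  have hs : 0 < √|x| := Real.sqrt_pos.2 (abs_pos.2 hx)
  have hp : 0 < R + κ := by linarith
  have hn := hk.le_norm R hR
  have h1 := norm_cexp_sub_one_le x R
  rw [abs_of_nonneg hR, Real.sqrt_mul (abs_nonneg x)] at h1
  rw [norm_div, norm_mul, norm_mul, norm_I, one_mul, norm_real, Real.norm_eq_abs]
  calc _ ≤ (2 * (√|x| * √R)) / (|x| * (c * (R + κ))) := by
        have := abs_pos.2 hx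
        gcongr
    _ = _ := by
        have e1 : |x| = √|x| ^ 2 := (Real.sq_sqrt (abs_nonneg x)).symm
        generalize √|x| = s at *
        rw [e1]
        field_simp

omit hk in
theorem aestronglyMeasurable_partsIntegrand (x : ℝ) :
    AEStronglyMeasurable (partsIntegrand k x) (volume.restrict (Set.Ioi 0)) := by
  unfold partsIntegrand
  exact Measurable.aestronglyMeasurable (by fun_prop)

theorem integrableOn_partsIntegrand {x : ℝ} (hx : x ≠ 0) :
    IntegrableOn (partsIntegrand k x) (Set.Ioi 0) :=
  ((integrableOn_majorant hk.κ_pos).const_mul (2 / c ^ 2 * (√|x|)⁻¹)).mono'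
    (aestronglyMeasurable_partsIntegrand x)
    ((ae_restrict_mem measurableSet_Ioi).mono fun _ hξ =>
      hk.norm_partsIntegrand_le hx (le_of_lt hξ))

/-- The bound is uniform in `R`, so that it can serve as a dominating function when `R → ∞`. The
boundary term uses `√R √κ ≤ R + κ`, the integral uses `integral_majorant`. -/
theorem norm_truncG_le {x R : ℝ} (hx : x ≠ 0) (hR : 0 ≤ R) :
    ‖truncG k R x‖ ≤ (2 / c + 4 / c ^ 2) * (√(κ * |x|))⁻¹ := by
  have hc := hk.c_pos
  have hκ := hk.κ_pos
  have hs : 0 < √|x| := Real.sqrt_pos.2 (abs_pos.2 hx)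
  have hsκ : 0 < √κ := Real.sqrt_pos.2 hκ
  rw [hk.truncG_eq hx hR]
  have h1 := hk.norm_boundary_le hx hR
  have h2 : √R * (R + κ)⁻¹ ≤ (√κ)⁻¹ := by
    rw [← div_eq_mul_inv, div_le_iff₀ (by linarith), inv_mul_eq_div, le_div_iff₀ hsκ]
    have e1 := Real.sq_sqrt hR
    have e2 := Real.sq_sqrt hκ.le
    nlinarith [sq_nonneg (√R - √κ), Real.sqrt_nonneg R]
  have h3 : ‖∫ ξ in (0 : ℝ)..R, partsIntegrand k x ξ‖ ≤
      2 / c ^ 2 * (√|x|)⁻¹ * (2 * (√κ)⁻¹) := by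
    rw [intervalIntegral.integral_of_le hR, ← integral_majorant hκ, ← integral_const_mul]
    have hi := (integrableOn_majorant hκ).const_mul (2 / c ^ 2 * (√|x|)⁻¹)
    refine (norm_integral_le_of_norm_le (IntegrableOn.mono_set hi Set.Ioc_subset_Ioi_self)
      ((ae_restrict_mem measurableSet_Ioc).mono fun ξ hξ =>
        hk.norm_partsIntegrand_le hx hξ.1.le)).trans ?_
    refine setIntegral_mono_set hi ((ae_restrict_mem measurableSet_Ioi).mono fun ξ hξ => ?_)
      (Set.Ioc_subset_Ioi_self : Set.Ioc 0 R ⊆ Set.Ioi 0).eventuallyLE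
    have := majorant_nonneg hκ (le_of_lt hξ)
    simp only [Pi.zero_apply]
    positivity
  refine (norm_add_le _ _).trans ?_
  rw [Real.sqrt_mul hκ.le, mul_inv]
  have h4 : 2 / c * (√|x|)⁻¹ * (√R * (R + κ)⁻¹) ≤ 2 / c * (√|x|)⁻¹ * (√κ)⁻¹ := by gcongr
  calc _ ≤ 2 / c * (√|x|)⁻¹ * (√κ)⁻¹ + 2 / c ^ 2 * (√|x|)⁻¹ * (2 * (√κ)⁻¹) := by linarith
    _ = _ := by ring

theorem tendsto_truncG {x : ℝ} (hx : x ≠ 0) :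
    Tendsto (fun R => truncG k R x) atTop (𝓝 (∫ ξ in Set.Ioi (0 : ℝ), partsIntegrand k x ξ)) := by
  have h1 := intervalIntegral_tendsto_integral_Ioi 0 (hk.integrableOn_partsIntegrand hx) tendsto_id
  have h2 : Tendsto (fun R : ℝ => (cexp (I * x * R) - 1) / (I * x * ((R : ℂ) - k))) atTop (𝓝 0) := by
    have h3 : Tendsto (fun R : ℝ => 2 / c * (√|x|)⁻¹ * (√R)⁻¹) atTop (𝓝 0) := by
      simpa using (Real.tendsto_sqrt_atTop.inv_tendsto_atTop).const_mul (2 / c * (√|x|)⁻¹)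
    refine squeeze_zero_norm' ?_ h3
    filter_upwards [eventually_gt_atTop 0] with R hR
    refine (hk.norm_boundary_le hx hR.le).trans ?_
    have hc := hk.c_pos
    have hκ := hk.κ_pos
    have : √R * (R + κ)⁻¹ ≤ (√R)⁻¹ := by
      have hs := Real.sqrt_pos.2 hR
      rw [← div_eq_mul_inv, div_le_iff₀ (by linarith), inv_mul_eq_div, le_div_iff₀ hs]
      nlinarith [Real.sq_sqrt hR.le]
    gcongr
  have h := h2.add h1
  rw [zero_add] at h
  refine h.congr' ?_
  filter_upwards [eventually_ge_atTop 0] with R hR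
  exact (hk.truncG_eq hx hR).symm

theorem tendsto_kernelG {x : ℝ} (hx : x ≠ 0) :
    Tendsto (fun R => 1 / (2 * (Real.pi : ℂ)) * truncG k R x) atTop (𝓝 (kernelG k x)) := by
  have h := hk.tendsto_truncG hx
  rw [kernelG]
  refine Tendsto.const_mul _ ?_
  exact tendsto_nhds_limUnder ⟨_, h⟩

theorem kernelG_eq {x : ℝ} (hx : x ≠ 0) :
    kernelG k x = 1 / (2 * (Real.pi : ℂ)) * ∫ ξ in Set.Ioi (0 : ℝ), partsIntegrand k x ξ :=
  tendsto_nhds_unique (hk.tendsto_kernelG hx) ((hk.tendsto_truncG hx).const_mul _)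

omit hk in
theorem norm_one_div_two_pi_le : ‖1 / (2 * (Real.pi : ℂ))‖ ≤ 1 := by
  rw [norm_div, norm_one, norm_mul, norm_real, Real.norm_eq_abs, abs_of_pos Real.pi_pos,
    RCLike.norm_two, div_le_one (by positivity)]
  linarith [Real.pi_gt_three]

theorem norm_const_mul_truncG_le {x R : ℝ} (hx : x ≠ 0) (hR : 0 ≤ R) :
    ‖1 / (2 * (Real.pi : ℂ)) * truncG k R x‖ ≤ (2 / c + 4 / c ^ 2) * (√(κ * |x|))⁻¹ := by
  rw [norm_mul]
  calc _ ≤ 1 * ‖truncG k R x‖ := by gcongr; exact norm_one_div_two_pi_le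
    _ ≤ _ := by rw [one_mul]; exact hk.norm_truncG_le hx hR

theorem norm_kernelG_le {x : ℝ} (hx : x ≠ 0) :
    ‖kernelG k x‖ ≤ (2 / c + 4 / c ^ 2) * (√(κ * |x|))⁻¹ :=
  le_of_tendsto (hk.tendsto_kernelG hx).norm (by
    filter_upwards [eventually_ge_atTop 0] with R hR
    exact hk.norm_const_mul_truncG_le hx hR)

theorem continuous_truncG {R : ℝ} (hR : 0 ≤ R) : Continuous (truncG k R) := by
  have hk0 : ∀ ξ : ℝ, ξ ∈ Set.uIcc 0 R → (ξ : ℂ) - k ≠ 0 := fun ξ hξ => by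
    rw [Set.uIcc_of_le hR] at hξ; exact hk.sub_ne_zero hξ.1
  refine intervalIntegral.continuous_of_dominated_interval
    (bound := fun ξ => ‖(ξ : ℂ) - k‖⁻¹) (fun x => ?_) (fun x => ?_) ?_ ?_
  · exact Measurable.aestronglyMeasurable (by fun_prop)
  · refine Eventually.of_forall fun ξ _ => ?_
    rw [norm_div, norm_cexp_I_mul_mul, one_div]
  · refine ContinuousOn.intervalIntegrable (ContinuousOn.inv₀ (by fun_prop) fun ξ hξ => ?_)
    exact norm_ne_zero_iff.2 (hk0 ξ hξ)
  · exact Eventually.of_forall fun ξ _ => by fun_prop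

theorem aestronglyMeasurable_kernelG : AEStronglyMeasurable (kernelG k) volume := by
  refine aestronglyMeasurable_of_tendsto_ae (u := (atTop : Filter ℕ))
    (f := fun n x => 1 / (2 * (Real.pi : ℂ)) * truncG k (n : ℝ) x) (fun n => ?_) ?_
  · exact ((hk.continuous_truncG n.cast_nonneg).const_mul _).aestronglyMeasurable
  · filter_upwards [compl_mem_ae_iff.2 (measure_singleton (0 : ℝ))] with x hx
    exact (hk.tendsto_kernelG hx).comp tendsto_natCast_atTop_atTop

end AwayFromCut

/-- In the left half-plane `|ξ - k|² ≥ ξ² + |k|²`. With `c = 1/2` the constant `2/c + 4/c²` of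
`norm_kernelG_le` is the 20 of `IsSplit`. -/
theorem awayFromCut_of_re_nonpos {k : ℂ} (hre : k.re ≤ 0) (h0 : k ≠ 0) :
    AwayFromCut k (1 / 2) ‖k‖ where
  c_pos := by norm_num
  κ_pos := norm_pos_iff.2 h0
  le_norm ξ hξ := by
    have h1 : ‖(ξ : ℂ) - k‖ ^ 2 = (ξ - k.re) ^ 2 + k.im ^ 2 := by
      rw [← normSq_eq_norm_sq, normSq_apply]; simp; ring
    have h2 : ‖k‖ ^ 2 = k.re ^ 2 + k.im ^ 2 := by
      rw [← normSq_eq_norm_sq, normSq_apply]; ring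
    refine le_of_sq_le_sq ?_ (norm_nonneg _)
    nlinarith [norm_nonneg k, sq_nonneg (ξ - ‖k‖), mul_nonneg hξ (neg_nonneg.2 hre)]

/-! ### Fourier transform of Schwartz functions -/

open scoped FourierTransform in
/-- `hat f` as a Schwartz function. -/
noncomputable def hatS (f : 𝓢(ℝ, ℂ)) : 𝓢(ℝ, ℂ) :=
  SchwartzMap.compCLMOfContinuousLinearEquiv ℂ
    (ContinuousLinearEquiv.unitsEquivAut ℝ (Units.mk0 (2 * Real.pi)⁻¹ (by positivity))) (𝓕 f)

open scoped FourierTransform in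
theorem hat_eq_fourier (f : ℝ → ℂ) (ξ : ℝ) : hat f ξ = 𝓕 f (ξ * (2 * Real.pi)⁻¹) := by
  rw [Real.fourier_real_eq_integral_exp_smul, hat]
  congr 1
  ext x
  rw [smul_eq_mul]
  congr 2
  have := Real.pi_ne_zero
  push_cast
  field_simp

theorem hatS_apply (f : 𝓢(ℝ, ℂ)) (ξ : ℝ) : hatS f ξ = hat f ξ := by
  rw [hat_eq_fourier]
  rfl

/-- The operator `D = -i d/dx` on Schwartz functions. -/
noncomputable def opD (f : 𝓢(ℝ, ℂ)) : 𝓢(ℝ, ℂ) := (-I) • SchwartzMap.derivCLM ℂ ℂ f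

theorem opD_apply (f : 𝓢(ℝ, ℂ)) (x : ℝ) : opD f x = -I * deriv f x := rfl

theorem hat_deriv (f : 𝓢(ℝ, ℂ)) (ξ : ℝ) : hat (deriv f) ξ = I * ξ * hat f ξ := by
  rw [hat_eq_fourier, hat_eq_fourier,
    Real.fourier_deriv f.integrable f.differentiable (SchwartzMap.derivCLM ℂ ℂ f).integrable]
  have := Real.pi_ne_zero
  simp only [smul_eq_mul]
  push_cast
  field_simp

theorem hat_opD (f : 𝓢(ℝ, ℂ)) (ξ : ℝ) : hat (opD f) ξ = ξ * hat f ξ := by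
  have h : hat (opD f) ξ = -I * hat (deriv f) ξ := by
    rw [hat, hat, ← integral_const_mul]
    congr 1
    ext x
    rw [opD_apply]
    ring
  rw [h, hat_deriv]
  linear_combination (-(ξ : ℂ) * hat f ξ) * I_sq

open scoped FourierTransform in
theorem integral_hat_eq_of_integrable {f : ℝ → ℂ} (hc : Continuous f) (hi : Integrable f)
    (hh : Integrable (hat f)) (x : ℝ) :
    1 / (2 * (Real.pi : ℂ)) * ∫ ξ : ℝ, cexp (I * x * ξ) * hat f ξ = f x := by
  have hpi := Real.pi_pos
  have hF : Integrable (𝓕 f) := by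
    refine (hh.comp_mul_right' (R := 2 * Real.pi) (by positivity)).congr
      (Eventually.of_forall fun w => ?_)
    simp only [hat_eq_fourier]
    rw [mul_inv_cancel_right₀ (by positivity)]
  have h := congrFun (hc.fourierInv_fourier_eq hi hF) x
  rw [Real.fourierInv_eq'] at h
  have h2 := Measure.integral_comp_mul_right
    (fun ξ : ℝ => cexp (I * x * ξ) * hat f ξ) (2 * Real.pi)
  rw [abs_of_pos (by positivity), eq_inv_smul_iff₀ (by positivity)] at h2
  rw [← h2, ← h]
  rw [real_smul, ← mul_assoc]
  push_cast
  rw [one_div_mul_cancel (by exact_mod_cast (by positivity : (2 * Real.pi) ≠ 0)), one_mul]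
  congr 1
  ext v
  rw [smul_eq_mul, hat_eq_fourier, mul_inv_cancel_right₀ (by positivity)]
  congr 2
  simp
  ring

/-- Polynomial decay of a Schwartz function, in a convenient form. -/
theorem exists_decay (f : 𝓢(ℝ, ℂ)) (N : ℕ) :
    ∃ C : ℝ, 0 < C ∧ ∀ x : ℝ, (1 + |x|) ^ N * ‖f x‖ ≤ C := by
  refine ⟨2 ^ N * ((Finset.Iic (N, 0)).sup fun m => SchwartzMap.seminorm ℂ m.1 m.2) f + 1,
    by positivity, fun x => ?_⟩
  have := SchwartzMap.one_add_le_sup_seminorm_apply (𝕜 := ℂ) (m := (N, 0)) le_rfl le_rfl f x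
  simp only [norm_iteratedFDeriv_zero, Real.norm_eq_abs] at this
  linarith

theorem integrable_hat (f : 𝓢(ℝ, ℂ)) : Integrable (hat f) := by
  have := (hatS f).integrable (μ := volume)
  rwa [show (hatS f : ℝ → ℂ) = hat f from funext (hatS_apply f)] at this

theorem continuous_hat (f : 𝓢(ℝ, ℂ)) : Continuous (hat f) := by
  have := (hatS f).continuous
  rwa [show (hatS f : ℝ → ℂ) = hat f from funext (hatS_apply f)] at this

theorem exists_hat_decay (f : 𝓢(ℝ, ℂ)) (N : ℕ) :
    ∃ C : ℝ, 0 < C ∧ ∀ ξ : ℝ, (1 + |ξ|) ^ N * ‖hat f ξ‖ ≤ C := by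
  simpa only [hatS_apply] using exists_decay (hatS f) N

theorem integrable_cexp_mul_hat (f : 𝓢(ℝ, ℂ)) (x : ℝ) :
    Integrable fun ξ : ℝ => cexp (I * x * ξ) * hat f ξ := by
  refine (integrable_hat f).norm.mono' ?_ (Eventually.of_forall fun ξ => ?_)
  · exact (Continuous.mul (by fun_prop) (continuous_hat f)).aestronglyMeasurable
  · rw [norm_mul, norm_cexp_I_mul_mul, one_mul]

/-! ### Temperate growth -/

/-- All iterated derivatives stay in a class of bounded functions, so the growth exponent 0 suffices
at every order. -/
theorem hasTemperateGrowth_of_deriv_closed {E : Type*} [NormedAddCommGroup E] [NormedSpace ℝ E]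
    (P : (ℝ → E) → Prop) (hd : ∀ f, P f → Differentiable ℝ f ∧ P (deriv f))
    (hb : ∀ f, P f → ∃ C, ∀ x, ‖f x‖ ≤ C) {f : ℝ → E} (hf : P f) :
    Function.HasTemperateGrowth f := by
  have hc : ∀ n : ℕ, ∀ f, P f → ContDiff ℝ n f ∧ P (iteratedDeriv n f) := by
    intro n
    induction n with
    | zero => intro f hf; exact ⟨contDiff_zero.2 (hd f hf).1.continuous, by simpa using hf⟩
    | succ n ih =>
      intro f hf
      obtain ⟨h1, h2⟩ := hd f hf
      refine ⟨?_, ?_⟩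
      · rw [Nat.cast_succ, contDiff_succ_iff_deriv]
        exact ⟨h1, by simp, (ih _ h2).1⟩
      · rw [iteratedDeriv_succ']
        exact (ih _ h2).2
  refine ⟨contDiff_infty.2 fun n => (hc n f hf).1, fun n => ?_⟩
  obtain ⟨C, hC⟩ := hb _ (hc n f hf).2
  refine ⟨0, C, fun x => ?_⟩
  rw [norm_iteratedFDeriv_eq_norm_iteratedDeriv, pow_zero, mul_one]
  exact hC x

theorem hasDerivAt_cauchyPlus (f : 𝓢(ℝ, ℂ)) (x : ℝ) :
    HasDerivAt (cauchyPlus f) (cauchyPlus (deriv f) x) x := by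
  have key : HasDerivAt (fun x : ℝ => ∫ ξ in Set.Ioi (0 : ℝ), cexp (I * x * ξ) * hat f ξ)
      (∫ ξ in Set.Ioi (0 : ℝ), cexp (I * x * ξ) * hat (deriv f) ξ) x := by
    refine (hasDerivAt_integral_of_dominated_loc_of_deriv_le (bound := fun ξ => ‖hat (deriv f) ξ‖)
      (F := fun (x ξ : ℝ) => cexp (I * x * ξ) * hat f ξ)
      (F' := fun (x ξ : ℝ) => cexp (I * x * ξ) * hat (deriv f) ξ) (s := Set.univ) univ_mem
      ?_ ?_ ?_ ?_ ?_ ?_).2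
    · exact Eventually.of_forall fun x => (integrable_cexp_mul_hat f x).aestronglyMeasurable.restrict
    · exact (integrable_cexp_mul_hat f x).integrableOn
    · exact (integrable_cexp_mul_hat (SchwartzMap.derivCLM ℂ ℂ f)
        x).aestronglyMeasurable.restrict
    · refine Eventually.of_forall fun ξ x _ => ?_
      rw [norm_mul, norm_cexp_I_mul_mul, one_mul]
    · exact (integrable_hat (SchwartzMap.derivCLM ℂ ℂ f)).norm.integrableOn
    · refine Eventually.of_forall fun ξ x _ => ?_
      have h := (hasDerivAt_cexp_I_mul ξ x).mul_const (hat f ξ)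
      simp only [mul_right_comm I (ξ : ℂ)] at h
      refine h.congr_deriv ?_
      rw [hat_deriv]
      ring
  exact key.const_mul _

theorem norm_cauchyPlus_le (f : 𝓢(ℝ, ℂ)) (x : ℝ) : ‖cauchyPlus f x‖ ≤ ∫ ξ, ‖hat f ξ‖ := by
  rw [cauchyPlus, norm_mul]
  calc _ ≤ 1 * ∫ ξ in Set.Ioi (0 : ℝ), ‖hat f ξ‖ := by
        gcongr
        · exact AwayFromCut.norm_one_div_two_pi_le
        · refine (norm_integral_le_integral_norm _).trans_eq ?_
          simp only [norm_mul, norm_cexp_I_mul_mul, one_mul]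
    _ ≤ _ := by
        rw [one_mul]
        exact setIntegral_le_integral (integrable_hat f).norm
          (Eventually.of_forall fun ξ => norm_nonneg _)

/-- `C₊` commutes with differentiation and is bounded by the `L¹` norm of the transform. In general
`C₊f` is not Schwartz, as its transform may jump at 0; temperate growth is what makes `u C₊f`
Schwartz. -/
theorem hasTemperateGrowth_cauchyPlus (f : 𝓢(ℝ, ℂ)) :
    Function.HasTemperateGrowth (cauchyPlus f) := by
  refine hasTemperateGrowth_of_deriv_closed (fun F => ∃ g : 𝓢(ℝ, ℂ), F = cauchyPlus g)
    ?_ ?_ ⟨f, rfl⟩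
  · rintro _ ⟨g, rfl⟩
    exact ⟨fun x => (hasDerivAt_cauchyPlus g x).differentiableAt,
      SchwartzMap.derivCLM ℂ ℂ g, funext fun x => (hasDerivAt_cauchyPlus g x).deriv⟩
  · rintro _ ⟨g, rfl⟩
    exact ⟨_, norm_cauchyPlus_le g⟩

theorem hasDerivAt_integral_Iic {u : ℝ → ℝ} (hc : Continuous u) (hi : Integrable u) (x : ℝ) :
    HasDerivAt (fun x => ∫ t in Set.Iic x, u t) (u x) x := by
  have h : ∀ y, ∫ t in Set.Iic y, u t = (∫ t in Set.Iic (0 : ℝ), u t) + ∫ t in (0 : ℝ)..y, u t :=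
    fun y => by
      rw [← intervalIntegral.integral_Iic_sub_Iic hi.integrableOn hi.integrableOn]
      ring
  rw [funext h]
  exact (intervalIntegral.integral_hasDerivAt_right (hc.intervalIntegrable _ _)
    (hc.stronglyMeasurableAtFilter _ _) hc.continuousAt).const_add _

theorem hasTemperateGrowth_integral_Iic (u : 𝓢(ℝ, ℝ)) :
    Function.HasTemperateGrowth fun x => ∫ t in Set.Iic x, u t := by
  refine hasTemperateGrowth_of_deriv_closed
    (fun F => F = (fun x => ∫ t in Set.Iic x, u t) ∨ ∃ g : 𝓢(ℝ, ℝ), F = g) ?_ ?_ (Or.inl rfl)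
  · rintro _ (rfl | ⟨g, rfl⟩)
    · exact ⟨fun x => (hasDerivAt_integral_Iic u.continuous u.integrable x).differentiableAt,
        Or.inr ⟨u, funext fun x => (hasDerivAt_integral_Iic u.continuous u.integrable x).deriv⟩⟩
    · exact ⟨g.differentiable, Or.inr ⟨SchwartzMap.derivCLM ℝ ℝ g, rfl⟩⟩
  · rintro _ (rfl | ⟨g, rfl⟩)
    · refine ⟨∫ t, ‖u t‖, fun x => (norm_integral_le_integral_norm _).trans ?_⟩
      exact setIntegral_le_integral u.integrable.norm (Eventually.of_forall fun _ => norm_nonneg _)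
    · refine ⟨SchwartzMap.seminorm ℝ 0 0 g, fun x => ?_⟩
      exact g.norm_le_seminorm ℝ x

theorem hasTemperateGrowth_cexp_I_mul (a : ℝ) :
    Function.HasTemperateGrowth fun t : ℝ => cexp (I * a * t) := by
  refine hasTemperateGrowth_of_deriv_closed
    (fun F => ∃ c : ℂ, F = fun t : ℝ => c * cexp (I * a * t)) ?_ ?_ ⟨1, by simp⟩
  · rintro _ ⟨c, rfl⟩
    have h := fun t : ℝ => (hasDerivAt_cexp_I_mul a t).const_mul c
    refine ⟨fun t => (h t).differentiableAt, c * (I * a), funext fun t => ?_⟩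
    rw [(h t).deriv]
    ring
  · rintro _ ⟨c, rfl⟩
    refine ⟨‖c‖, fun t => ?_⟩
    rw [norm_mul, norm_cexp_I_mul_mul, mul_one]

/-- The complexification of a real Schwartz function. -/
noncomputable def complexify (u : 𝓢(ℝ, ℝ)) : 𝓢(ℝ, ℂ) :=
  SchwartzMap.postcompCLM ofRealCLM u

theorem complexify_apply (u : 𝓢(ℝ, ℝ)) (x : ℝ) : complexify u x = (u x : ℂ) := rfl

/-! ### Convolution with the singularity `|x|^{-1/2}` -/

theorem integrable_singularity :
    Integrable ((Set.Ioc (-1 : ℝ) 1).indicator fun z => (√|z|)⁻¹) := by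
  rw [integrable_indicator_iff measurableSet_Ioc]
  have h1 : IntervalIntegrable (fun z : ℝ => (√|z|)⁻¹) volume 0 1 := by
    refine (intervalIntegral.intervalIntegrable_rpow' (a := 0) (b := 1)
      (show (-1 : ℝ) < -(1 / 2) by norm_num)).congr fun z hz => ?_
    rw [Set.uIoc_of_le zero_le_one] at hz
    rw [abs_of_pos hz.1, Real.sqrt_eq_rpow, Real.rpow_neg hz.1.le]
  have h2 : IntervalIntegrable (fun z : ℝ => (√|z|)⁻¹) volume (-1) 0 := by
    have := (IntervalIntegrable.iff_comp_neg (by simp)).1 h1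
    simpa using this.symm
  exact (intervalIntegrable_iff_integrableOn_Ioc_of_le (by norm_num)).1 (h2.trans h1)

/-- The mass of `|x|^{-1/2}` on `(-1, 1]`. -/
noncomputable def singularMass : ℝ := ∫ z, (Set.Ioc (-1 : ℝ) 1).indicator (fun z => (√|z|)⁻¹) z

theorem singularMass_nonneg : 0 ≤ singularMass :=
  integral_nonneg fun _ => Set.indicator_nonneg (fun _ _ => by positivity) _

variable {f : ℝ → ℂ} {B : ℝ}

/-- Near the singularity the sup bound of `f` is used; at distance at least 1 the singular factor is
at most 1. -/
theorem inv_sqrt_mul_norm_le {x y : ℝ} (hb : ‖f y‖ ≤ B) :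
    (√|x - y|)⁻¹ * ‖f y‖ ≤
      B * (Set.Ioc (-1 : ℝ) 1).indicator (fun z => (√|z|)⁻¹) (x - y) + ‖f y‖ := by
  by_cases h : x - y ∈ Set.Ioc (-1 : ℝ) 1
  · rw [Set.indicator_of_mem h]
    have : 0 ≤ (√|x - y|)⁻¹ := by positivity
    nlinarith [norm_nonneg (f y)]
  · rw [Set.indicator_of_notMem h, mul_zero, zero_add]
    have h1 : 1 ≤ |x - y| := by
      by_contra hlt
      push Not at hlt
      rw [abs_lt] at hlt
      exact h ⟨hlt.1, hlt.2.le⟩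
    have h2 : 1 ≤ √|x - y| := by rw [← Real.sqrt_one]; exact Real.sqrt_le_sqrt h1
    exact mul_le_of_le_one_left (norm_nonneg _) (inv_le_one_of_one_le₀ h2)

theorem integrable_inv_sqrt_mul (hf : Integrable f) (hb : ∀ᵐ y, ‖f y‖ ≤ B) (x : ℝ) :
    Integrable fun y => (√|x - y|)⁻¹ * ‖f y‖ := by
  refine (((integrable_singularity.comp_sub_left x).const_mul B).add hf.norm).mono' ?_ ?_
  · exact (Measurable.aestronglyMeasurable (by fun_prop)).mul hf.aestronglyMeasurable.norm
  · filter_upwards [hb] with y hy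
    rw [Real.norm_of_nonneg (by positivity)]
    exact inv_sqrt_mul_norm_le hy

theorem integral_inv_sqrt_mul_le (hf : Integrable f) (hb : ∀ᵐ y, ‖f y‖ ≤ B) (x : ℝ) :
    ∫ y, (√|x - y|)⁻¹ * ‖f y‖ ≤ B * singularMass + ∫ y, ‖f y‖ := by
  have hs := (integrable_singularity.comp_sub_left x).const_mul B
  calc _ ≤ ∫ y, (B * (Set.Ioc (-1 : ℝ) 1).indicator (fun z => (√|z|)⁻¹) (x - y) + ‖f y‖) :=
        integral_mono_ae (integrable_inv_sqrt_mul hf hb x) (hs.add hf.norm)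
          (hb.mono fun y hy => inv_sqrt_mul_norm_le hy)
    _ = _ := by
        rw [integral_add hs hf.norm, integral_const_mul,
          integral_sub_left_eq_self _ volume x, singularMass]

/-! ### The Fourier representation of the convolution -/

theorem integral_truncG_mul {k : ℂ} {c κ : ℝ} (hk : AwayFromCut k c κ) (hf : Integrable f)
    {R : ℝ} (hR : 0 ≤ R) (x : ℝ) :
    ∫ y, truncG k R (x - y) * f y =
      ∫ ξ in (0 : ℝ)..R, cexp (I * x * ξ) * hat f ξ / ((ξ : ℂ) - k) := by
  have hi : Integrable (fun ξ : ℝ => ((ξ : ℂ) - k)⁻¹) (volume.restrict (Set.Ioc 0 R)) := by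
    refine IntegrableOn.mono_set (ContinuousOn.integrableOn_Icc
      (ContinuousOn.inv₀ (by fun_prop) fun ξ hξ => hk.sub_ne_zero hξ.1)) Set.Ioc_subset_Icc_self
  have hint : Integrable (Function.uncurry fun y ξ : ℝ =>
      cexp (I * ((x - y : ℝ) : ℂ) * ξ) / ((ξ : ℂ) - k) * f y)
      (volume.prod (volume.restrict (Set.Ioc 0 R))) := by
    refine (hf.mul_prod hi).norm.mono' ?_ (Eventually.of_forall fun p => ?_)
    · refine AEStronglyMeasurable.mul (Measurable.aestronglyMeasurable ?_) ?_
      · fun_prop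
      · exact hf.aestronglyMeasurable.comp_fst
    · simp only [Function.uncurry, norm_mul, norm_div, norm_cexp_I_mul_mul, norm_inv, one_div]
      rw [mul_comm]
  rw [intervalIntegral.integral_of_le hR]
  calc _ = ∫ y, ∫ ξ in Set.Ioc 0 R,
        cexp (I * ((x - y : ℝ) : ℂ) * ξ) / ((ξ : ℂ) - k) * f y := by
        congr 1
        ext y
        rw [truncG, intervalIntegral.integral_of_le hR, integral_mul_const]
    _ = ∫ ξ in Set.Ioc 0 R, ∫ y, cexp (I * ((x - y : ℝ) : ℂ) * ξ) / ((ξ : ℂ) - k) * f y :=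
        integral_integral_swap hint
    _ = _ := by
        congr 1
        ext ξ
        rw [hat, ← integral_const_mul, ← integral_div]
        congr 1
        ext y
        rw [show I * ((x - y : ℝ) : ℂ) * ξ = I * x * ξ + -(I * ξ * y) by push_cast; ring,
          Complex.exp_add]
        ring

namespace AwayFromCut

variable {k : ℂ} {c κ : ℝ} (hk : AwayFromCut k c κ)

include hk

theorem integrableOn_cexp_mul_hat_div (hh : Integrable (hat f)) (x : ℝ) :
    IntegrableOn (fun ξ : ℝ => cexp (I * x * ξ) * hat f ξ / ((ξ : ℂ) - k)) (Set.Ioi 0) := by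
  have hc := hk.c_pos
  have hκ := hk.κ_pos
  refine (hh.norm.const_mul (c * κ)⁻¹).integrableOn.mono' ?_
    ((ae_restrict_mem measurableSet_Ioi).mono fun ξ hξ => ?_)
  · simp only [div_eq_mul_inv]
    exact ((Measurable.aestronglyMeasurable (by fun_prop)).mul
      hh.aestronglyMeasurable.restrict).mul (Measurable.aestronglyMeasurable (by fun_prop))
  · have h0 : 0 < ξ := hξ
    have h1 : c * κ ≤ ‖(ξ : ℂ) - k‖ := le_trans (by gcongr; linarith) (hk.le_norm ξ h0.le)
    rw [norm_div, norm_mul, norm_cexp_I_mul_mul, one_mul, div_eq_inv_mul]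
    gcongr

/-- Fubini needs the truncated kernel (`integral_truncG_mul`). The truncation is then removed on
both sides, on the left by domination with a multiple of `(κ |x - y|)^{-1/2} |f(y)|`. -/
theorem integral_kernelG_mul (hf : Integrable f) (hb : ∀ᵐ y, ‖f y‖ ≤ B)
    (hh : Integrable (hat f)) (x : ℝ) :
    ∫ y, kernelG k (x - y) * f y = 1 / (2 * (Real.pi : ℂ)) *
      ∫ ξ in Set.Ioi (0 : ℝ), cexp (I * x * ξ) * hat f ξ / ((ξ : ℂ) - k) := by
  have hne : ∀ᵐ y : ℝ, x - y ≠ 0 := by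
    filter_upwards [compl_mem_ae_iff.2 (measure_singleton x)] with y hy
    exact _root_.sub_ne_zero.2 (Ne.symm hy)
  have h1 : Tendsto (fun n : ℕ => ∫ y, 1 / (2 * (Real.pi : ℂ)) * truncG k n (x - y) * f y) atTop
      (𝓝 (∫ y, kernelG k (x - y) * f y)) := by
    refine tendsto_integral_of_dominated_convergence
      (fun y => (2 / c + 4 / c ^ 2) * (√κ)⁻¹ * ((√|x - y|)⁻¹ * ‖f y‖)) (fun n => ?_)
      ((integrable_inv_sqrt_mul hf hb x).const_mul _) (fun n => ?_) ?_
    · have := hk.continuous_truncG n.cast_nonneg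
      exact (Continuous.aestronglyMeasurable (by fun_prop)).mul hf.aestronglyMeasurable
    · filter_upwards [hne] with y hy
      rw [norm_mul]
      refine (mul_le_mul_of_nonneg_right (hk.norm_const_mul_truncG_le hy n.cast_nonneg)
        (norm_nonneg _)).trans_eq ?_
      rw [Real.sqrt_mul hk.κ_pos.le, mul_inv]
      ring
    · filter_upwards [hne] with y hy
      exact ((hk.tendsto_kernelG hy).comp tendsto_natCast_atTop_atTop).mul_const _
  have h2 := ((intervalIntegral_tendsto_integral_Ioi 0
    (hk.integrableOn_cexp_mul_hat_div hh x) tendsto_id).comp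
      tendsto_natCast_atTop_atTop).const_mul (1 / (2 * (Real.pi : ℂ)))
  refine tendsto_nhds_unique h1 (h2.congr fun n => ?_)
  simp only [Function.comp, id, mul_assoc (1 / (2 * (Real.pi : ℂ)))]
  rw [integral_const_mul, integral_truncG_mul hk hf n.cast_nonneg]

-- The substitution `ξ ↦ -ξ`. It gives the boundary kernels the same shape, residue plus reflected
-- kernel, as the kernels at interior points.
omit hk in
theorem kernelGTilde_eq (hk : AwayFromCut (-k) c κ) {x : ℝ} (hx : x ≠ 0) :
    kernelGTilde k x = -kernelG (-k) (-x) := by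
  have h : ∀ R : ℝ, ∫ ξ in (-R)..(0 : ℝ), cexp (I * x * ξ) / ((ξ : ℂ) - k) =
      -truncG (-k) R (-x) := by
    intro R
    have := intervalIntegral.integral_comp_neg (a := 0) (b := R)
      (fun ξ : ℝ => cexp (I * x * ξ) / ((ξ : ℂ) - k))
    rw [neg_zero] at this
    rw [← this, truncG, ← intervalIntegral.integral_neg]
    congr 1
    ext ξ
    rw [← div_neg]
    push_cast
    congr 2 <;> ring
  have h2 := (hk.tendsto_truncG (neg_ne_zero.2 hx)).neg
  rw [hk.kernelG_eq (neg_ne_zero.2 hx), kernelGTilde]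
  simp_rw [h]
  rw [h2.limUnder_eq]
  ring

end AwayFromCut

theorem hat_comp_neg (f : ℝ → ℂ) (ξ : ℝ) : hat (fun y => f (-y)) ξ = hat f (-ξ) := by
  rw [hat, hat, ← integral_neg_eq_self]
  congr 1
  ext y
  push_cast
  rw [neg_neg]
  congr 2
  ring

theorem AwayFromCut.integral_kernelG_neg_mul {k : ℂ} {c κ : ℝ} (hk : AwayFromCut (-k) c κ)
    (hf : Integrable f) (hb : ∀ᵐ y, ‖f y‖ ≤ B) (hh : Integrable (hat f)) (x : ℝ) :
    ∫ y, kernelG (-k) (-(x - y)) * f y = -(1 / (2 * (Real.pi : ℂ)) *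
      ∫ ξ in Set.Iic (0 : ℝ), cexp (I * x * ξ) * hat f ξ / ((ξ : ℂ) - k)) := by
  have hh' : Integrable (hat fun y => f (-y)) := by
    rw [show (hat fun y => f (-y)) = fun ξ => hat f (-ξ) from funext (hat_comp_neg f)]
    exact hh.comp_neg
  have hb' : ∀ᵐ y, ‖f (-y)‖ ≤ B :=
    (Measure.measurePreserving_neg volume).quasiMeasurePreserving.ae hb
  have := hk.integral_kernelG_mul hf.comp_neg hb' hh' (-x)
  rw [← integral_neg_eq_self]
  calc _ = ∫ y, kernelG (-k) (-x - y) * f (-y) := by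
        congr 1
        ext y
        congr 2
        ring
    _ = _ := by
        rw [this, ← mul_neg, ← integral_neg,
          ← neg_zero (G := ℝ), ← integral_comp_neg_Ioi, neg_zero]
        congr 2
        ext ξ
        rw [hat_comp_neg, ← div_neg]
        push_cast
        congr 3 <;> ring

/-! ### The residue of the kernel across the cut -/

/-- Here `c` degenerates as `k` approaches the half-line. It serves only to make the integrals
converge and to represent them; the uniform bounds come from the reflected pole. -/
theorem awayFromCut_of_im_ne_zero {k : ℂ} (him : k.im ≠ 0) :
    AwayFromCut k (1 + 2 * ‖k‖ / |k.im|)⁻¹ ‖k‖ where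
  c_pos := by positivity
  κ_pos := norm_pos_iff.2 fun h => him (by simp [h])
  le_norm ξ hξ := by
    have hpos := abs_pos.2 him
    have h1 : |k.im| ≤ ‖(ξ : ℂ) - k‖ := by
      simpa using abs_im_le_norm ((ξ : ℂ) - k)
    have h2 : ξ - ‖k‖ ≤ ‖(ξ : ℂ) - k‖ := by
      have := norm_sub_norm_le (ξ : ℂ) k
      rwa [norm_real, Real.norm_of_nonneg hξ] at this
    rw [inv_mul_le_iff₀ (by positivity), add_mul, one_mul]
    have h3 : 2 * ‖k‖ ≤ 2 * ‖k‖ / |k.im| * ‖(ξ : ℂ) - k‖ := by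
      rw [div_mul_eq_mul_div, le_div_iff₀ hpos]
      gcongr
    linarith

theorem norm_cexp_I_mul_mul_complex (k : ℂ) (x : ℝ) :
    ‖cexp (I * k * x)‖ = Real.exp (-(k.im * x)) := by
  rw [norm_exp]
  simp

theorem integrableOn_mul_cexp {a : ℂ} (ha : 0 < a.re) :
    IntegrableOn (fun x : ℝ => (x : ℂ) * cexp (-(a * x))) (Set.Ioi 0) := by
  have h := integrableOn_rpow_mul_exp_neg_mul_rpow (p := 1) (s := 1) (by norm_num) (by norm_num) ha
  refine h.mono' (Measurable.aestronglyMeasurable (by fun_prop))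
    ((ae_restrict_mem measurableSet_Ioi).mono fun x hx => ?_)
  rw [norm_mul, norm_real, Real.norm_of_nonneg (le_of_lt hx), norm_exp, Real.rpow_one]
  simp

theorem integral_mul_cexp {a : ℂ} (ha : 0 < a.re) :
    ∫ x in Set.Ioi (0 : ℝ), (x : ℂ) * cexp (-(a * x)) = 1 / a ^ 2 := by
  have ha0 : a ≠ 0 := fun h => by simp [h] at ha
  have hd : ∀ x : ℝ, HasDerivAt (fun x : ℝ => -((x : ℂ) / a + 1 / a ^ 2) * cexp (-(a * x)))
      ((x : ℂ) * cexp (-(a * x))) x := by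
    intro x
    have h1 : HasDerivAt (fun x : ℝ => (x : ℂ)) 1 x := HasDerivAt.ofReal_comp (hasDerivAt_id x)
    have h2 := ((h1.const_mul a).neg).cexp
    refine ((((h1.div_const a).add_const (1 / a ^ 2)).neg).mul h2).congr_deriv ?_
    simp only [Pi.neg_apply]
    field_simp
    ring
  have hn : ∀ x : ℝ, ‖cexp (-(a * x))‖ = Real.exp (-(a.re * x)) := fun x => by
    rw [norm_exp]; simp
  have hlim : Tendsto (fun x : ℝ => -((x : ℂ) / a + 1 / a ^ 2) * cexp (-(a * x))) atTop (𝓝 0) := by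
    have t1 : Tendsto (fun x : ℝ => x ^ 1 * Real.exp (-(a.re * x))) atTop (𝓝 0) := by
      have := Real.tendsto_pow_mul_exp_neg_atTop_nhds_zero 1
      have h3 := (this.comp (tendsto_id.const_mul_atTop ha)).const_mul (a.re)⁻¹
      rw [mul_zero] at h3
      refine h3.congr fun x => ?_
      simp only [Function.comp, id]
      field_simp
    have t0 : Tendsto (fun x : ℝ => Real.exp (-(a.re * x))) atTop (𝓝 0) :=
      Real.tendsto_exp_neg_atTop_nhds_zero.comp (tendsto_id.const_mul_atTop ha)
    have t2 := (t1.const_mul ‖a‖⁻¹).add (t0.const_mul ‖1 / a ^ 2‖)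
    rw [mul_zero, mul_zero, add_zero] at t2
    refine squeeze_zero_norm' ?_ t2
    filter_upwards [eventually_ge_atTop 0] with x hx
    rw [norm_mul, norm_neg, hn]
    calc _ ≤ (‖(x : ℂ) / a‖ + ‖1 / a ^ 2‖) * Real.exp (-(a.re * x)) := by
          gcongr; exact norm_add_le _ _
      _ = _ := by
          rw [norm_div, norm_real, Real.norm_of_nonneg hx]
          ring
  rw [integral_Ioi_of_hasDerivAt_of_tendsto' (fun x _ => hd x) (integrableOn_mul_cexp ha) hlim]
  simp

/-- The function with Fourier transform `1 / (ξ - k) ^ 2` for `Im k > 0`. -/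
noncomputable def doublePole (k : ℂ) (x : ℝ) : ℂ := -((max x 0 : ℝ) : ℂ) * cexp (I * k * x)

theorem doublePole_eq_indicator (k : ℂ) (ξ : ℝ) : (fun x : ℝ => cexp (-(I * ξ * x)) *
    doublePole k x) = (Set.Ioi (0 : ℝ)).indicator
      fun x : ℝ => -((x : ℂ) * cexp (-(I * (ξ - k) * x))) := by
  ext x
  unfold doublePole
  by_cases hx : 0 < x
  · rw [Set.indicator_of_mem (Set.mem_Ioi.2 hx), max_eq_left hx.le,
      show -(I * ((ξ : ℂ) - k) * x) = -(I * ξ * x) + I * k * x by ring, Complex.exp_add]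
    ring
  · rw [Set.indicator_of_notMem (by simpa using hx), max_eq_right (not_lt.1 hx)]
    simp

theorem continuous_doublePole (k : ℂ) : Continuous (doublePole k) := by
  unfold doublePole
  fun_prop

variable {k : ℂ}

theorem integrable_doublePole (him : 0 < k.im) : Integrable (doublePole k) := by
  have h := doublePole_eq_indicator k 0
  have h0 : (fun x : ℝ => cexp (-(I * (0 : ℝ) * x)) * doublePole k x) = doublePole k := by
    ext x; simp
  rw [← h0, h, integrable_indicator_iff measurableSet_Ioi]
  exact (integrableOn_mul_cexp (a := I * (((0 : ℝ) : ℂ) - k)) (by simpa using him)).neg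

theorem hat_doublePole (him : 0 < k.im) (ξ : ℝ) : hat (doublePole k) ξ = 1 / ((ξ : ℂ) - k) ^ 2 := by
  rw [hat, doublePole_eq_indicator, integral_indicator measurableSet_Ioi, integral_neg,
    integral_mul_cexp (by simpa using him), mul_pow, I_sq]
  rw [neg_one_mul, div_neg, neg_neg]

theorem integrable_inv_sq (him : k.im ≠ 0) : Integrable fun ξ : ℝ => 1 / ((ξ : ℂ) - k) ^ 2 := by
  have h := (integrable_inv_one_add_sq.comp_sub_right k.re).const_mul (1 + 1 / k.im ^ 2)
  refine h.mono' (Measurable.aestronglyMeasurable (by fun_prop)) (Eventually.of_forall fun ξ => ?_)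
  have h1 : ‖(ξ : ℂ) - k‖ ^ 2 = (ξ - k.re) ^ 2 + k.im ^ 2 := by
    rw [← normSq_eq_norm_sq, normSq_apply]; simp; ring
  have hp : 0 < k.im ^ 2 := by positivity
  rw [norm_div, norm_one, norm_pow, h1, ← div_eq_mul_inv, div_le_div_iff₀ (by positivity)
    (by positivity)]
  have : (1 + 1 / k.im ^ 2) * ((ξ - k.re) ^ 2 + k.im ^ 2) =
    (ξ - k.re) ^ 2 + k.im ^ 2 + (ξ - k.re) ^ 2 / k.im ^ 2 + 1 := by field_simp; ring
  rw [this]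
  have : 0 ≤ (ξ - k.re) ^ 2 / k.im ^ 2 := by positivity
  linarith

/-- For `Im k > 0` the kernels for `k` and for the reflected point `-k` differ by a residue. -/
theorem kernelG_eq_of_im_pos {c κ c' κ' : ℝ} (hk : AwayFromCut k c κ) (hk' : AwayFromCut (-k) c' κ')
    (him : 0 < k.im) {x : ℝ} (hx : x ≠ 0) :
    kernelG k x = (Set.Ioi (0 : ℝ)).indicator (fun y : ℝ => I * cexp (I * k * y)) x +
      kernelG (-k) (-x) := by
  have hxC : (x : ℂ) ≠ 0 := by exact_mod_cast hx
  have h1 := hk.integrableOn_partsIntegrand hx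
  have h2 := hk'.integrableOn_partsIntegrand (neg_ne_zero.2 hx)
  have hrefl : (fun ξ : ℝ => partsIntegrand (-k) (-x) ξ) = fun ξ => -partsIntegrand k x (-ξ) := by
    ext ξ
    unfold partsIntegrand
    rw [← div_neg]
    push_cast
    congr 1
    · congr 2; ring
    · ring
  have e2 : ∫ ξ in Set.Ioi (0 : ℝ), partsIntegrand (-k) (-x) ξ =
      -∫ ξ in Set.Iic (0 : ℝ), partsIntegrand k x ξ := by
    rw [hrefl, integral_neg, integral_comp_neg_Ioi, neg_zero]
  have hi2 := integrable_inv_sq him.ne'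
  have hi1 : Integrable fun ξ : ℝ => cexp (I * x * ξ) * (1 / ((ξ : ℂ) - k) ^ 2) := by
    refine hi2.norm.mono' (Measurable.aestronglyMeasurable (by fun_prop))
      (Eventually.of_forall fun ξ => ?_)
    rw [norm_mul, norm_cexp_I_mul_mul, one_mul]
  have hsplit : partsIntegrand k x = fun ξ : ℝ => (I * x)⁻¹ *
      (cexp (I * x * ξ) * (1 / ((ξ : ℂ) - k) ^ 2) - 1 / ((ξ : ℂ) - k) ^ 2) := by
    ext ξ
    unfold partsIntegrand
    rw [mul_comm (I * (x : ℂ)) (_ ^ 2), div_mul_eq_div_div, div_eq_inv_mul _ (I * (x : ℂ))]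
    ring
  have hi : Integrable (partsIntegrand k x) := by
    rw [hsplit]
    exact (hi1.sub hi2).const_mul _
  -- The two half-line integrals join into one over `ℝ`. Fourier inversion for `doublePole k`, at
  -- `x` and at 0, evaluates it and takes the place of a residue computation.
  have inv := fun x => integral_hat_eq_of_integrable (continuous_doublePole k)
    (integrable_doublePole him) (by
      rw [show hat (doublePole k) = _ from funext (hat_doublePole him)]; exact hi2) x
  simp only [hat_doublePole him] at inv
  have inv0 := inv 0
  simp only [ofReal_zero, mul_zero, zero_mul, Complex.exp_zero, one_mul] at inv0
  have htot : 1 / (2 * (Real.pi : ℂ)) * ∫ ξ : ℝ, partsIntegrand k x ξ =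
      (I * x)⁻¹ * (doublePole k x - doublePole k 0) := by
    rw [← inv x, ← inv0, hsplit, integral_const_mul, integral_sub hi1 hi2]
    ring
  have hsum : kernelG k x - kernelG (-k) (-x) =
      1 / (2 * (Real.pi : ℂ)) * ∫ ξ : ℝ, partsIntegrand k x ξ := by
    rw [hk.kernelG_eq hx, hk'.kernelG_eq (neg_ne_zero.2 hx), e2,
      ← intervalIntegral.integral_Iic_add_Ioi hi.integrableOn hi.integrableOn]
    ring
  rw [← sub_eq_iff_eq_add, hsum, htot]
  unfold doublePole
  rw [max_self, ofReal_zero, neg_zero, zero_mul, sub_zero]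
  by_cases h : 0 < x
  · rw [Set.indicator_of_mem (Set.mem_Ioi.2 h), max_eq_left h.le]
    have := I_ne_zero
    field_simp
    rw [I_sq]
  · rw [Set.indicator_of_notMem (by simpa using h), max_eq_right (not_lt.1 h)]
    simp

theorem AwayFromCut.conj {c κ : ℝ} (hk : AwayFromCut k c κ) :
    AwayFromCut ((starRingEnd ℂ) k) c κ where
  c_pos := hk.c_pos
  κ_pos := hk.κ_pos
  le_norm ξ hξ := by
    rw [show (ξ : ℂ) - (starRingEnd ℂ) k = (starRingEnd ℂ) ((ξ : ℂ) - k) by simp, norm_conj]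
    exact hk.le_norm ξ hξ

theorem kernelG_conj {c κ : ℝ} (hk : AwayFromCut k c κ) {x : ℝ} (hx : x ≠ 0) :
    (starRingEnd ℂ) (kernelG k x) = kernelG ((starRingEnd ℂ) k) (-x) := by
  rw [hk.kernelG_eq hx, hk.conj.kernelG_eq (neg_ne_zero.2 hx), map_mul, ← integral_conj]
  congr 1
  · simp [map_ofNat]
  · congr 1
    ext ξ
    unfold partsIntegrand
    simp only [map_div₀, map_sub, map_mul, map_pow, conj_I, conj_ofReal, map_one, ← exp_conj,
      ofReal_neg]
    congr 2
    · congr 1; ring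
    · ring

/-- Conjugation together with `x ↦ -x` exchanges the two half-planes. -/
theorem kernelG_eq_of_im_neg {c κ c' κ' : ℝ} (hk : AwayFromCut k c κ) (hk' : AwayFromCut (-k) c' κ')
    (him : k.im < 0) {x : ℝ} (hx : x ≠ 0) :
    kernelG k x = (Set.Iio (0 : ℝ)).indicator (fun y : ℝ => -I * cexp (I * k * y)) x +
      kernelG (-k) (-x) := by
  have hc' : AwayFromCut (-(starRingEnd ℂ) k) c' κ' := by simpa using hk'.conj
  have h := kernelG_eq_of_im_pos hk.conj hc' (by simpa using him) (neg_ne_zero.2 hx)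
  have h1 := congrArg (starRingEnd ℂ) h
  rw [map_add, ← kernelG_conj hk hx, conj_conj, neg_neg, kernelG_conj hc' hx, map_neg,
    conj_conj] at h1
  rw [h1]
  congr 1
  by_cases h0 : x < 0
  · rw [Set.indicator_of_mem (Set.mem_Iio.2 h0), Set.indicator_of_mem (by simpa using h0)]
    simp [← exp_conj]
  · rw [Set.indicator_of_notMem (by simpa using h0), Set.indicator_of_notMem (by simpa using h0)]
    simp

/-! ### Splitting of the kernels -/

/-- `G` is the sum of a one-sided kernel bounded by `1` and of a kernel of size
`(κ |x|)^{-1/2}`. -/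
structure IsSplit (G P R : ℝ → ℂ) (κ : ℝ) : Prop where
  κ_pos : 0 < κ
  eq_add : ∀ x, x ≠ 0 → G x = P x + R x
  meas_left : AEStronglyMeasurable P volume
  meas_right : AEStronglyMeasurable R volume
  norm_left_le : ∀ x, ‖P x‖ ≤ 1
  one_sided : (∀ x < 0, P x = 0) ∨ ∀ x > 0, P x = 0
  norm_right_le : ∀ x, x ≠ 0 → ‖R x‖ ≤ 20 * (√(κ * |x|))⁻¹

theorem AwayFromCut.aestronglyMeasurable_kernelG_neg {c κ : ℝ} (hk : AwayFromCut k c κ) :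
    AEStronglyMeasurable (fun x => kernelG k (-x)) volume :=
  hk.aestronglyMeasurable_kernelG.comp_quasiMeasurePreserving
    (Measure.measurePreserving_neg volume).quasiMeasurePreserving

theorem norm_kernelG_neg_le (hre : 0 ≤ k.re) (h0 : k ≠ 0) {x : ℝ} (hx : x ≠ 0) :
    ‖kernelG (-k) (-x)‖ ≤ 20 * (√(‖k‖ * |x|))⁻¹ := by
  have h := (awayFromCut_of_re_nonpos (k := -k) (by simpa using hre)
    (neg_ne_zero.2 h0)).norm_kernelG_le (neg_ne_zero.2 hx)
  rw [norm_neg, abs_neg] at h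
  norm_num at h ⊢
  exact h

theorem isSplit_of_re_nonpos (hre : k.re ≤ 0) (h0 : k ≠ 0) :
    IsSplit (kernelG k) 0 (kernelG k) ‖k‖ where
  κ_pos := norm_pos_iff.2 h0
  eq_add _ _ := by simp
  meas_left := aestronglyMeasurable_zero
  meas_right := (awayFromCut_of_re_nonpos hre h0).aestronglyMeasurable_kernelG
  norm_left_le _ := by simp
  one_sided := Or.inl fun _ _ => rfl
  norm_right_le x hx := by
    have h := (awayFromCut_of_re_nonpos hre h0).norm_kernelG_le hx
    norm_num at h ⊢
    exact h

theorem isSplit_above {G : ℝ → ℂ} (hre : 0 < k.re) (him : 0 ≤ k.im)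
    (hG : ∀ x, x ≠ 0 → G x = (Set.Ioi (0 : ℝ)).indicator (fun y : ℝ => I * cexp (I * k * y)) x +
      kernelG (-k) (-x)) :
    IsSplit G ((Set.Ioi (0 : ℝ)).indicator fun y : ℝ => I * cexp (I * k * y))
      (fun x => kernelG (-k) (-x)) ‖k‖ where
  κ_pos := norm_pos_iff.2 fun h => by simp [h] at hre
  eq_add := hG
  meas_left := (Measurable.aestronglyMeasurable (by fun_prop)).indicator measurableSet_Ioi
  meas_right := (awayFromCut_of_re_nonpos (k := -k) (by simpa using hre.le)
    (neg_ne_zero.2 fun h => by simp [h] at hre)).aestronglyMeasurable_kernelG_neg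
  norm_left_le x := by
    by_cases h : x ∈ Set.Ioi (0 : ℝ)
    · rw [Set.indicator_of_mem h, norm_mul, norm_I, one_mul, norm_cexp_I_mul_mul_complex]
      exact Real.exp_le_one_iff.2 (neg_nonpos.2 (mul_nonneg him (le_of_lt h)))
    · rw [Set.indicator_of_notMem h]; simp
  one_sided := Or.inl fun x hx => Set.indicator_of_notMem (by simpa using hx.le) _
  norm_right_le x hx := norm_kernelG_neg_le hre.le (fun h => by simp [h] at hre) hx

theorem isSplit_below {G : ℝ → ℂ} (hre : 0 < k.re) (him : k.im ≤ 0)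
    (hG : ∀ x, x ≠ 0 → G x = (Set.Iio (0 : ℝ)).indicator (fun y : ℝ => -I * cexp (I * k * y)) x +
      kernelG (-k) (-x)) :
    IsSplit G ((Set.Iio (0 : ℝ)).indicator fun y : ℝ => -I * cexp (I * k * y))
      (fun x => kernelG (-k) (-x)) ‖k‖ where
  κ_pos := norm_pos_iff.2 fun h => by simp [h] at hre
  eq_add := hG
  meas_left := (Measurable.aestronglyMeasurable (by fun_prop)).indicator measurableSet_Iio
  meas_right := (awayFromCut_of_re_nonpos (k := -k) (by simpa using hre.le)
    (neg_ne_zero.2 fun h => by simp [h] at hre)).aestronglyMeasurable_kernelG_neg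
  norm_left_le x := by
    by_cases h : x ∈ Set.Iio (0 : ℝ)
    · rw [Set.indicator_of_mem h, norm_mul, norm_neg, norm_I, one_mul, norm_cexp_I_mul_mul_complex]
      exact Real.exp_le_one_iff.2 (neg_nonpos.2 (mul_nonneg_of_nonpos_of_nonpos him (le_of_lt h)))
    · rw [Set.indicator_of_notMem h]; simp
  one_sided := Or.inr fun x hx => Set.indicator_of_notMem (by simpa using le_of_lt hx) _
  norm_right_le x hx := norm_kernelG_neg_le hre.le (fun h => by simp [h] at hre) hx

theorem awayFromCut_neg_ofReal {l : ℝ} (hl : 0 < l) : AwayFromCut (-(l : ℂ)) (1 / 2) ‖-(l : ℂ)‖ :=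
  awayFromCut_of_re_nonpos (by simpa using hl.le) (by simpa using hl.ne')

theorem kernelAbove_eq {l : ℝ} (hl : 0 < l) {x : ℝ} (hx : x ≠ 0) :
    kernelAbove l x = (Set.Ioi (0 : ℝ)).indicator (fun y : ℝ => I * cexp (I * (l : ℂ) * y)) x +
      kernelG (-(l : ℂ)) (-x) := by
  rw [kernelAbove, AwayFromCut.kernelGTilde_eq (awayFromCut_neg_ofReal hl) hx, sub_neg_eq_add]
  rfl

theorem kernelBelow_eq {l : ℝ} (hl : 0 < l) {x : ℝ} (hx : x ≠ 0) :
    kernelBelow l x = (Set.Iio (0 : ℝ)).indicator (fun y : ℝ => -I * cexp (I * (l : ℂ) * y)) x +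
      kernelG (-(l : ℂ)) (-x) := by
  rw [kernelBelow, AwayFromCut.kernelGTilde_eq (awayFromCut_neg_ofReal hl) hx, sub_neg_eq_add]
  rfl

/-- The sign of `Re k` decides whether the pole is reflected; the sign of `Im k`, or the side of the
cut, decides on which half-line the exponential lives, always the one where it does not grow. -/
theorem CutPlane.exists_isSplit (k : CutPlane) : ∃ P R, IsSplit k.kernel P R ‖k.val‖ := by
  match k with
  | .interior k hk =>
    have h0 : k ≠ 0 := by simpa using hk 0 le_rfl
    rcases le_or_gt k.re 0 with hre | hre
    · exact ⟨_, _, isSplit_of_re_nonpos hre h0⟩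
    · have him : k.im ≠ 0 := fun him => hk k.re hre.le (Complex.ext (by simp) (by simpa using him))
      have h1 := awayFromCut_of_im_ne_zero him
      have h2 := awayFromCut_of_im_ne_zero (k := -k) (by simpa using him)
      rcases lt_or_gt_of_ne him with h | h
      · exact ⟨_, _, isSplit_below hre h.le fun x hx => kernelG_eq_of_im_neg h1 h2 h hx⟩
      · exact ⟨_, _, isSplit_above hre h.le fun x hx => kernelG_eq_of_im_pos h1 h2 h hx⟩
  | .above l hl =>
    exact ⟨_, _, isSplit_above (k := (l : ℂ)) (by simpa using hl) (by simp)
      fun x hx => kernelAbove_eq hl hx⟩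
  | .below l hl =>
    exact ⟨_, _, isSplit_below (k := (l : ℂ)) (by simpa using hl) (by simp)
      fun x hx => kernelBelow_eq hl hx⟩

/-! ### Convolution with a split kernel -/

namespace IsSplit

variable {G P R f : ℝ → ℂ} {κ B : ℝ} (h : IsSplit G P R κ)

include h

omit h in
theorem aestronglyMeasurable_comp_sub_left {Q : ℝ → ℂ} (hQ : AEStronglyMeasurable Q volume)
    (x : ℝ) : AEStronglyMeasurable (fun y => Q (x - y)) volume :=
  hQ.comp_quasiMeasurePreserving (Measure.measurePreserving_sub_left volume x).quasiMeasurePreserving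

omit h in
theorem ae_sub_ne_zero (x : ℝ) : ∀ᵐ y : ℝ, x - y ≠ 0 := by
  filter_upwards [compl_mem_ae_iff.2 (measure_singleton x)] with y hy
  exact sub_ne_zero.2 (Ne.symm hy)

theorem integrable_left_mul (hf : Integrable f) (x : ℝ) : Integrable fun y => P (x - y) * f y :=
  hf.norm.mono' ((aestronglyMeasurable_comp_sub_left h.meas_left x).mul hf.aestronglyMeasurable)
    (Eventually.of_forall fun y => by
      rw [norm_mul]
      exact mul_le_of_le_one_left (norm_nonneg _) (h.norm_left_le _))

theorem norm_right_mul_le (f : ℝ → ℂ) {x y : ℝ} (hy : x - y ≠ 0) :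
    ‖R (x - y) * f y‖ ≤ 20 * (√κ)⁻¹ * ((√|x - y|)⁻¹ * ‖f y‖) := by
  rw [norm_mul]
  refine (mul_le_mul_of_nonneg_right (h.norm_right_le _ hy) (norm_nonneg _)).trans_eq ?_
  rw [Real.sqrt_mul h.κ_pos.le, mul_inv]
  ring

theorem integrable_right_mul (hf : Integrable f) (hb : ∀ᵐ y, ‖f y‖ ≤ B) (x : ℝ) :
    Integrable fun y => R (x - y) * f y :=
  ((integrable_inv_sqrt_mul hf hb x).const_mul (20 * (√κ)⁻¹)).mono'
    ((aestronglyMeasurable_comp_sub_left h.meas_right x).mul hf.aestronglyMeasurable)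
    ((ae_sub_ne_zero x).mono fun _ hy => h.norm_right_mul_le f hy)

theorem ae_eq_add (f : ℝ → ℂ) (x : ℝ) : (fun y => G (x - y) * f y) =ᵐ[volume]
    fun y => P (x - y) * f y + R (x - y) * f y := by
  filter_upwards [ae_sub_ne_zero x] with y hy
  rw [h.eq_add _ hy, add_mul]

theorem integrable_mul (hf : Integrable f) (hb : ∀ᵐ y, ‖f y‖ ≤ B) (x : ℝ) :
    Integrable fun y => G (x - y) * f y :=
  ((h.integrable_left_mul hf x).add (h.integrable_right_mul hf hb x)).congr (h.ae_eq_add f x).symm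

theorem integral_mul (hf : Integrable f) (hb : ∀ᵐ y, ‖f y‖ ≤ B) (x : ℝ) :
    ∫ y, G (x - y) * f y = (∫ y, P (x - y) * f y) + ∫ y, R (x - y) * f y := by
  rw [integral_congr_ae (h.ae_eq_add f x),
    integral_add (h.integrable_left_mul hf x) (h.integrable_right_mul hf hb x)]

theorem integral_norm_right_mul_le (hf : Integrable f) (hb : ∀ᵐ y, ‖f y‖ ≤ B) (x : ℝ) :
    ∫ y, ‖R (x - y) * f y‖ ≤ 20 * (√κ)⁻¹ * (B * singularMass + ∫ y, ‖f y‖) := by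
  calc _ ≤ ∫ y, 20 * (√κ)⁻¹ * ((√|x - y|)⁻¹ * ‖f y‖) :=
        integral_mono_ae (h.integrable_right_mul hf hb x).norm
          ((integrable_inv_sqrt_mul hf hb x).const_mul _)
          ((ae_sub_ne_zero x).mono fun _ hy => h.norm_right_mul_le f hy)
    _ ≤ _ := by
        rw [integral_const_mul]
        gcongr
        exact integral_inv_sqrt_mul_le hf hb x

theorem norm_integral_mul_le (hf : Integrable f) (hb : ∀ᵐ y, ‖f y‖ ≤ B) (x : ℝ) :
    ‖∫ y, G (x - y) * f y‖ ≤
      (∫ y, ‖f y‖) + 20 * (√κ)⁻¹ * (B * singularMass + ∫ y, ‖f y‖) := by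
  rw [h.integral_mul hf hb]
  refine (norm_add_le _ _).trans (add_le_add ?_ ?_)
  · refine (norm_integral_le_integral_norm _).trans ?_
    refine integral_mono (h.integrable_left_mul hf x).norm hf.norm fun y => ?_
    rw [norm_mul]
    exact mul_le_of_le_one_left (norm_nonneg _) (h.norm_left_le _)
  · exact (norm_integral_le_integral_norm _).trans (h.integral_norm_right_mul_le hf hb x)

theorem aestronglyMeasurable : AEStronglyMeasurable G volume := by
  refine (h.meas_left.add h.meas_right).congr ?_
  filter_upwards [compl_mem_ae_iff.2 (measure_singleton (0 : ℝ))] with x hx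
  exact (h.eq_add x hx).symm

end IsSplit

theorem ae_norm_schwartz_le (f : 𝓢(ℝ, ℂ)) :
    ∀ᵐ y, ‖f y‖ ≤ SchwartzMap.seminorm ℝ 0 0 f :=
  Eventually.of_forall fun y => f.norm_le_seminorm ℝ y

/-! ### The convolution with `G_k` and the operator `D` -/

theorem CutPlane.exists_awayFromCut {k : ℂ} (hk : ∀ t : ℝ, 0 ≤ t → k ≠ (t : ℂ)) :
    ∃ c, AwayFromCut k c ‖k‖ := by
  rcases le_or_gt k.re 0 with hre | hre
  · exact ⟨_, awayFromCut_of_re_nonpos hre (by simpa using hk 0 le_rfl)⟩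
  · exact ⟨_, awayFromCut_of_im_ne_zero fun him =>
      hk k.re hre.le (Complex.ext (by simp) (by simpa using him))⟩

theorem integral_indicator_Ioi_sub_mul (g f : ℝ → ℂ) (x : ℝ) :
    ∫ y, (Set.Ioi (0 : ℝ)).indicator g (x - y) * f y = ∫ y in Set.Iic x, g (x - y) * f y := by
  rw [integral_Iic_eq_integral_Iio, ← integral_indicator measurableSet_Iio]
  congr 1
  ext y
  by_cases hy : y < x
  · rw [Set.indicator_of_mem (by simpa using hy), Set.indicator_of_mem (by simpa using hy)]
  · rw [Set.indicator_of_notMem (by simpa using hy), Set.indicator_of_notMem (by simpa using hy),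
      zero_mul]

theorem integral_indicator_Iio_sub_mul (g f : ℝ → ℂ) (x : ℝ) :
    ∫ y, (Set.Iio (0 : ℝ)).indicator g (x - y) * f y = ∫ y in Set.Ioi x, g (x - y) * f y := by
  rw [← integral_indicator measurableSet_Ioi]
  congr 1
  ext y
  by_cases hy : x < y
  · rw [Set.indicator_of_mem (by simpa using hy), Set.indicator_of_mem (by simpa using hy)]
  · rw [Set.indicator_of_notMem (by simpa using hy), Set.indicator_of_notMem (by simpa using hy),
      zero_mul]

/-! ### The operator `D` on the two sides of the cut -/

section boundary

variable (f : 𝓢(ℝ, ℂ)) (l x : ℝ)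

theorem hasDerivAt_cexp_sub_mul (y : ℝ) :
    HasDerivAt (fun y : ℝ => cexp (I * l * ((x - y : ℝ) : ℂ)) * f y)
      (cexp (I * l * ((x - y : ℝ) : ℂ)) * deriv f y -
        I * l * (cexp (I * l * ((x - y : ℝ) : ℂ)) * f y)) y := by
  have h1 : HasDerivAt (fun y : ℝ => cexp (I * l * ((x - y : ℝ) : ℂ)))
      (-(I * l * cexp (I * l * ((x - y : ℝ) : ℂ)))) y := by
    have := (hasDerivAt_cexp_I_mul l (x - y)).scomp y ((hasDerivAt_id y).const_sub x)
    simpa [Function.comp_def] using this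
  refine (h1.mul (f.differentiableAt.hasDerivAt (x := y))).congr_deriv ?_
  ring

theorem integrable_cexp_sub_mul (f : 𝓢(ℝ, ℂ)) :
    Integrable fun y : ℝ => cexp (I * l * ((x - y : ℝ) : ℂ)) * f y := by
  refine f.integrable.norm.mono' (Continuous.aestronglyMeasurable ?_)
    (Eventually.of_forall fun y => ?_)
  · have := f.continuous
    fun_prop
  · rw [norm_mul, norm_cexp_I_mul_mul, one_mul]

theorem tendsto_cexp_sub_mul :
    Tendsto (fun y : ℝ => cexp (I * l * ((x - y : ℝ) : ℂ)) * f y) (cocompact ℝ) (𝓝 0) := by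
  have h : Tendsto f (cocompact ℝ) (𝓝 0) := f.tendsto_cocompact
  refine squeeze_zero_norm (fun y => ?_) (tendsto_zero_iff_norm_tendsto_zero.1 h)
  rw [norm_mul, norm_cexp_I_mul_mul, one_mul]

theorem integral_Iic_cexp_sub_mul_deriv :
    ∫ y in Set.Iic x, cexp (I * l * ((x - y : ℝ) : ℂ)) * deriv f y =
      f x + I * l * ∫ y in Set.Iic x, cexp (I * l * ((x - y : ℝ) : ℂ)) * f y := by
  have i1 : IntegrableOn (fun y : ℝ => cexp (I * l * ((x - y : ℝ) : ℂ)) * deriv f y) (Set.Iic x) :=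
    (integrable_cexp_sub_mul l x (SchwartzMap.derivCLM ℂ ℂ f)).integrableOn
  have i2 := ((integrable_cexp_sub_mul l x f).const_mul (I * l)).integrableOn (s := Set.Iic x)
  have := integral_Iic_of_hasDerivAt_of_tendsto' (fun y (_ : y ∈ Set.Iic x) =>
    hasDerivAt_cexp_sub_mul f l x y) (i1.sub i2)
    ((tendsto_cexp_sub_mul f l x).mono_left atBot_le_cocompact)
  rw [integral_sub i1 i2, integral_const_mul] at this
  simp only [sub_self, ofReal_zero, mul_zero, Complex.exp_zero, one_mul, sub_zero] at this
  exact sub_eq_iff_eq_add.1 this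

theorem integral_Ioi_cexp_sub_mul_deriv :
    ∫ y in Set.Ioi x, cexp (I * l * ((x - y : ℝ) : ℂ)) * deriv f y =
      -f x + I * l * ∫ y in Set.Ioi x, cexp (I * l * ((x - y : ℝ) : ℂ)) * f y := by
  have i1 : IntegrableOn (fun y : ℝ => cexp (I * l * ((x - y : ℝ) : ℂ)) * deriv f y) (Set.Ioi x) :=
    (integrable_cexp_sub_mul l x (SchwartzMap.derivCLM ℂ ℂ f)).integrableOn
  have i2 := ((integrable_cexp_sub_mul l x f).const_mul (I * l)).integrableOn (s := Set.Ioi x)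
  have := integral_Ioi_of_hasDerivAt_of_tendsto' (fun y (_ : y ∈ Set.Ici x) =>
    hasDerivAt_cexp_sub_mul f l x y) (i1.sub i2)
    ((tendsto_cexp_sub_mul f l x).mono_left atTop_le_cocompact)
  rw [integral_sub i1 i2, integral_const_mul] at this
  simp only [sub_self, ofReal_zero, mul_zero, Complex.exp_zero, one_mul, zero_sub] at this
  exact sub_eq_iff_eq_add.1 this

/-- Integration by parts on `(-∞, x]`. The boundary term `f x` cancels against the `-f x` of
`integral_kernelG_neg_mul_opD`. -/
theorem integral_residue_above_opD :
    ∫ y, (Set.Ioi (0 : ℝ)).indicator (fun y : ℝ => I * cexp (I * (l : ℂ) * y)) (x - y) * opD f y =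
      l * (∫ y, (Set.Ioi (0 : ℝ)).indicator
        (fun y : ℝ => I * cexp (I * (l : ℂ) * y)) (x - y) * f y) + f x := by
  rw [integral_indicator_Ioi_sub_mul, integral_indicator_Ioi_sub_mul]
  have e1 : ∀ y : ℝ, I * cexp (I * (l : ℂ) * ((x - y : ℝ) : ℂ)) * opD f y =
      cexp (I * l * ((x - y : ℝ) : ℂ)) * deriv f y := fun y => by
    rw [opD_apply]
    linear_combination (-cexp (I * l * ((x - y : ℝ) : ℂ)) * deriv f y) * I_sq
  simp only [e1, mul_assoc I (cexp _)]
  rw [integral_const_mul, integral_Iic_cexp_sub_mul_deriv]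
  ring

theorem integral_residue_below_opD :
    ∫ y, (Set.Iio (0 : ℝ)).indicator (fun y : ℝ => -I * cexp (I * (l : ℂ) * y)) (x - y) * opD f y =
      l * (∫ y, (Set.Iio (0 : ℝ)).indicator
        (fun y : ℝ => -I * cexp (I * (l : ℂ) * y)) (x - y) * f y) + f x := by
  rw [integral_indicator_Iio_sub_mul, integral_indicator_Iio_sub_mul]
  have e1 : ∀ y : ℝ, -I * cexp (I * (l : ℂ) * ((x - y : ℝ) : ℂ)) * opD f y =
      -(cexp (I * l * ((x - y : ℝ) : ℂ)) * deriv f y) := fun y => by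
    rw [opD_apply]
    linear_combination (cexp (I * l * ((x - y : ℝ) : ℂ)) * deriv f y) * I_sq
  simp only [e1, mul_assoc (-I) (cexp _)]
  rw [integral_const_mul, integral_neg, integral_Ioi_cexp_sub_mul_deriv]
  ring

theorem integral_kernelG_neg_mul_schwartz (hl : 0 < l) :
    ∫ y, kernelG (-(l : ℂ)) (-(x - y)) * f y = -(1 / (2 * (Real.pi : ℂ)) *
      ∫ ξ in Set.Iic (0 : ℝ), cexp (I * x * ξ) * hat f ξ / ((ξ : ℂ) - l)) :=
  (awayFromCut_neg_ofReal hl).integral_kernelG_neg_mul f.integrable (ae_norm_schwartz_le f)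
    (integrable_hat f) x

theorem integrableOn_Iic_cexp_mul_hat_div (hl : 0 < l) :
    IntegrableOn (fun ξ : ℝ => cexp (I * x * ξ) * hat f ξ / ((ξ : ℂ) - l)) (Set.Iic 0) := by
  refine ((integrable_hat f).norm.const_mul l⁻¹).integrableOn.mono' ?_
    ((ae_restrict_mem measurableSet_Iic).mono fun ξ hξ => ?_)
  · simp only [div_eq_mul_inv]
    exact (Measurable.aestronglyMeasurable (by have := (continuous_hat f).measurable; fun_prop))
  · have h0 : ξ ≤ 0 := hξ
    have h1 : l ≤ ‖(ξ : ℂ) - l‖ := by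
      rw [← ofReal_sub, norm_real, Real.norm_eq_abs, abs_of_nonpos (by linarith)]
      linarith
    rw [norm_div, norm_mul, norm_cexp_I_mul_mul, one_mul, div_eq_inv_mul]
    gcongr

/-- On the Fourier side `ξ / (ξ - l) = 1 + l / (ξ - l)`. The 1 leaves minus the negative-frequency
part of `f`, which is `C₊f - f` by Fourier inversion. -/
theorem integral_kernelG_neg_mul_opD (hl : 0 < l) :
    ∫ y, kernelG (-(l : ℂ)) (-(x - y)) * opD f y =
      l * (∫ y, kernelG (-(l : ℂ)) (-(x - y)) * f y) + cauchyPlus f x - f x := by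
  rw [integral_kernelG_neg_mul_schwartz _ _ _ hl, integral_kernelG_neg_mul_schwartz _ _ _ hl]
  have hne : ∀ ξ ∈ Set.Iic (0 : ℝ), (ξ : ℂ) - l ≠ 0 := fun ξ hξ => by
    have h0 : ξ ≤ 0 := hξ
    rw [← ofReal_sub]
    exact_mod_cast (by linarith : ξ - l < 0).ne
  have e1 : ∫ ξ in Set.Iic (0 : ℝ), cexp (I * x * ξ) * hat (opD f) ξ / ((ξ : ℂ) - l) =
      (∫ ξ in Set.Iic (0 : ℝ), cexp (I * x * ξ) * hat f ξ) +
        l * ∫ ξ in Set.Iic (0 : ℝ), cexp (I * x * ξ) * hat f ξ / ((ξ : ℂ) - l) := by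
    rw [← integral_const_mul, ← integral_add (integrable_cexp_mul_hat f x).integrableOn
      ((integrableOn_Iic_cexp_mul_hat_div f l x hl).const_mul _)]
    refine setIntegral_congr_fun measurableSet_Iic fun ξ hξ => ?_
    have := hne ξ hξ
    simp only [hat_opD]
    field_simp
    ring
  have e2 := integral_hat_eq_of_integrable f.continuous f.integrable (integrable_hat f) x
  rw [← intervalIntegral.integral_Iic_add_Ioi (integrable_cexp_mul_hat f x).integrableOn
    (integrable_cexp_mul_hat f x).integrableOn (b := 0)] at e2
  rw [e1, cauchyPlus]
  linear_combination -e2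

end boundary

/-- At interior points this is `ξ / (ξ - k) = 1 + k / (ξ - k)` under the Fourier integral; on the
cut the residue and the reflected kernel are treated separately and added. -/
theorem CutPlane.integral_kernel_mul_opD (k : CutPlane) (f : 𝓢(ℝ, ℂ)) (x : ℝ) :
    ∫ y, k.kernel (x - y) * opD f y =
      k.val * (∫ y, k.kernel (x - y) * f y) + cauchyPlus f x := by
  match k with
  | .interior k hk =>
    obtain ⟨c, hc⟩ := CutPlane.exists_awayFromCut hk
    simp only [CutPlane.kernel, CutPlane.val]
    rw [hc.integral_kernelG_mul f.integrable (ae_norm_schwartz_le f) (integrable_hat f),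
      hc.integral_kernelG_mul (opD f).integrable (ae_norm_schwartz_le _) (integrable_hat _)]
    have e1 : ∫ ξ in Set.Ioi (0 : ℝ), cexp (I * x * ξ) * hat (opD f) ξ / ((ξ : ℂ) - k) =
        (∫ ξ in Set.Ioi (0 : ℝ), cexp (I * x * ξ) * hat f ξ) +
          k * ∫ ξ in Set.Ioi (0 : ℝ), cexp (I * x * ξ) * hat f ξ / ((ξ : ℂ) - k) := by
      rw [← integral_const_mul, ← integral_add (integrable_cexp_mul_hat f x).integrableOn
        ((hc.integrableOn_cexp_mul_hat_div (integrable_hat f) x).const_mul _)]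
      refine setIntegral_congr_fun measurableSet_Ioi fun ξ hξ => ?_
      have := hc.sub_ne_zero (le_of_lt hξ)
      simp only [hat_opD]
      field_simp
      ring
    rw [e1, cauchyPlus]
    ring
  | .above l hl =>
    have hs := isSplit_above (k := (l : ℂ)) (by simpa using hl) (by simp)
      fun x hx => kernelAbove_eq hl hx
    simp only [CutPlane.kernel, CutPlane.val]
    rw [hs.integral_mul f.integrable (ae_norm_schwartz_le f),
      hs.integral_mul (opD f).integrable (ae_norm_schwartz_le _),
      integral_residue_above_opD, integral_kernelG_neg_mul_opD f l x hl]
    ring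
  | .below l hl =>
    have hs := isSplit_below (k := (l : ℂ)) (by simpa using hl) (by simp)
      fun x hx => kernelBelow_eq hl hx
    simp only [CutPlane.kernel, CutPlane.val]
    rw [hs.integral_mul f.integrable (ae_norm_schwartz_le f),
      hs.integral_mul (opD f).integrable (ae_norm_schwartz_le _),
      integral_residue_below_opD, integral_kernelG_neg_mul_opD f l x hl]
    ring

/-! ### Contractive integral operators on `L^∞` -/

/-- The kernel `K` defines an integral operator of norm at most `q < 1` on `L^∞`. -/
structure IsContractive (K : ℝ → ℝ → ℂ) (q : ℝ) : Prop where
  meas : AEStronglyMeasurable (Function.uncurry K) (volume.prod volume)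
  integrable : ∀ x, Integrable (K x)
  integral_le : ∀ x, ∫ y, ‖K x y‖ ≤ q
  lt_one : q < 1

namespace IsContractive

variable {K : ℝ → ℝ → ℂ} {q : ℝ} (h : IsContractive K q)

include h

theorem nonneg : 0 ≤ q := (integral_nonneg fun _ => norm_nonneg _).trans (h.integral_le 0)

theorem integrable_mul {n : ℝ → ℂ} (hm : AEStronglyMeasurable n volume) {M : ℝ}
    (hn : ∀ᵐ y, ‖n y‖ ≤ M) (x : ℝ) : Integrable fun y => K x y * n y :=
  (h.integrable x).mul_bdd hm hn

theorem norm_integral_mul_le {n : ℝ → ℂ} {M : ℝ}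
    (hn : ∀ᵐ y, ‖n y‖ ≤ M) (x : ℝ) : ‖∫ y, K x y * n y‖ ≤ q * M := by
  have hM : 0 ≤ M := by
    obtain ⟨y, hy⟩ := hn.exists
    exact (norm_nonneg _).trans hy
  calc _ ≤ ∫ y, ‖K x y‖ * M := by
        refine norm_integral_le_of_norm_le ((h.integrable x).norm.mul_const M) ?_
        filter_upwards [hn] with y hy
        rw [norm_mul]
        gcongr
    _ ≤ _ := by
        rw [integral_mul_const]
        exact mul_le_mul_of_nonneg_right (h.integral_le x) hM

theorem aestronglyMeasurable_integral_mul {n : ℝ → ℂ} (hm : AEStronglyMeasurable n volume) :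
    AEStronglyMeasurable (fun x => ∫ y, K x y * n y) volume :=
  AEStronglyMeasurable.integral_prod_right' (f := fun p => K p.1 p.2 * n p.2)
    (h.meas.mul hm.comp_snd)

/-- The norm `M` of `d` satisfies `M ≤ H + q M`. Since `d` is already known to be in `L^∞`, `M` is
finite and can be absorbed on the left. -/
theorem norm_le_of_ae_eq {d g : ℝ → ℂ} (hd : MemLp d ∞) {H : ℝ} (hg : ∀ᵐ x, ‖g x‖ ≤ H)
    (heq : ∀ᵐ x, d x = g x + ∫ y, K x y * d y) : ∀ᵐ x, ‖d x‖ ≤ H / (1 - q) := by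
  have hle := ae_le_lpNorm_exponent_top hd
  set M := lpNorm d ∞ volume
  have h1 : ∀ᵐ x, ‖d x‖ ≤ H + q * M := by
    filter_upwards [hg, heq] with x hx he
    rw [he]
    exact (norm_add_le _ _).trans (add_le_add hx (h.norm_integral_mul_le hle x))
  have h0 : 0 ≤ H + q * M := by
    obtain ⟨y, hy⟩ := h1.exists
    exact (norm_nonneg _).trans hy
  have h2 : M ≤ H + q * M := by
    have hM : M = (eLpNorm d ∞ volume).toReal := (toReal_eLpNorm hd.aestronglyMeasurable).symm
    refine hM.le.trans (ENNReal.toReal_le_of_le_ofReal h0 ?_)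
    rw [eLpNorm_exponent_top]
    exact eLpNormEssSup_le_of_ae_bound h1
  have h3 : 0 < 1 - q := by linarith [h.lt_one]
  filter_upwards [hle] with x hx
  refine hx.trans ?_
  rw [le_div_iff₀ h3]
  linarith

theorem exists_fixedPoint {g : ℝ → ℂ} (hg : MemLp g ∞) :
    ∃ n : ℝ → ℂ, MemLp n ∞ ∧ ∀ᵐ x, n x = g x + ∫ y, K x y * n y := by
  have hmem : ∀ n : ℝ → ℂ, MemLp n ∞ → MemLp (fun x => g x + ∫ y, K x y * n y) ∞ := fun n hn =>
    hg.add (memLp_top_of_bound (h.aestronglyMeasurable_integral_mul hn.aestronglyMeasurable) _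
      (Eventually.of_forall (h.norm_integral_mul_le (ae_le_lpNorm_exponent_top hn))))
  let Φ : Lp ℂ ∞ (volume : Measure ℝ) → Lp ℂ ∞ (volume : Measure ℝ) := fun n =>
    (hmem n (Lp.memLp n)).toLp
  have hΦ : ContractingWith ⟨q, h.nonneg⟩ Φ := by
    refine ⟨h.lt_one, LipschitzWith.of_dist_le_mul fun n n' => ?_⟩
    have e1 : dist n n' = lpNorm (⇑n - ⇑n') ∞ volume := by
      rw [Lp.dist_def, toReal_eLpNorm ((Lp.memLp n).sub (Lp.memLp n')).aestronglyMeasurable]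
    have hb := ae_le_lpNorm_exponent_top ((Lp.memLp n).sub (Lp.memLp n'))
    rw [e1, dist_edist, Lp.edist_toLp_toLp]
    refine ENNReal.toReal_le_of_le_ofReal (mul_nonneg h.nonneg lpNorm_nonneg) ?_
    rw [eLpNorm_exponent_top]
    refine eLpNormEssSup_le_of_ae_bound (Eventually.of_forall fun x => ?_)
    have i1 := h.integrable_mul (Lp.memLp n).aestronglyMeasurable
      (ae_le_lpNorm_exponent_top (Lp.memLp n)) x
    have i2 := h.integrable_mul (Lp.memLp n').aestronglyMeasurable
      (ae_le_lpNorm_exponent_top (Lp.memLp n')) x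
    rw [Pi.sub_apply, add_sub_add_left_eq_sub, ← integral_sub i1 i2]
    simp only [← mul_sub]
    exact h.norm_integral_mul_le hb x
  have : Nonempty (Lp ℂ ∞ (volume : Measure ℝ)) := ⟨0⟩
  have hfix := hΦ.fixedPoint_isFixedPt
  set n := ContractingWith.fixedPoint Φ hΦ
  refine ⟨n, Lp.memLp n, ?_⟩
  have := (hmem n (Lp.memLp n)).coeFn_toLp
  rw [show (hmem n (Lp.memLp n)).toLp = n from hfix] at this
  exact this

end IsContractive

/-! ### A weight that makes one-sided convolution contractive -/

/-- A Gronwall weight: `E = exp(2 ∫_{-∞}^x v)` has `E' = 2 v E` and tends to 1 at `-∞`, so `∫_{-∞}^x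
v E = (E x - 1) / 2`. No smallness of `v` is needed. -/
theorem exists_weight_of_left {v : ℝ → ℝ} (hc : Continuous v) (hi : Integrable v) (h0 : ∀ x, 0 ≤ v x)
    {P : ℝ → ℂ} (hP : ∀ x, ‖P x‖ ≤ 1)
    (hs : ∀ x < 0, P x = 0) :
    ∃ E : ℝ → ℝ, Continuous E ∧ (∀ x, 1 ≤ E x) ∧ (∀ x, E x ≤ Real.exp (2 * ∫ t, v t)) ∧
      ∀ x, ∫ y, ‖P (x - y)‖ * (v y * E y) ≤ E x / 2 := by
  have hd : ∀ x, HasDerivAt (fun x => Real.exp (2 * ∫ t in Set.Iic x, v t))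
      (Real.exp (2 * ∫ t in Set.Iic x, v t) * (2 * v x)) x := fun x =>
    ((hasDerivAt_integral_Iic hc hi x).const_mul 2).exp
  set E : ℝ → ℝ := fun x => Real.exp (2 * ∫ t in Set.Iic x, v t) with hE
  have hEc : Continuous E := continuous_iff_continuousAt.2 fun x => (hd x).continuousAt
  have hE1 : ∀ x, 1 ≤ E x := fun x =>
    Real.one_le_exp (mul_nonneg zero_le_two (integral_nonneg h0))
  have hEM : ∀ x, E x ≤ Real.exp (2 * ∫ t, v t) := fun x =>
    Real.exp_le_exp.2 (mul_le_mul_of_nonneg_left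
      (setIntegral_le_integral hi (Eventually.of_forall h0)) zero_le_two)
  have hvE : Integrable fun y => v y * E y :=
    hi.mul_bdd (c := Real.exp (2 * ∫ t, v t)) hEc.aestronglyMeasurable
      (Eventually.of_forall fun y => by
      rw [Real.norm_of_nonneg (zero_le_one.trans (hE1 y))]; exact hEM y)
  refine ⟨E, hEc, hE1, hEM, fun x => ?_⟩
  have hlim : Tendsto E atBot (𝓝 1) := by
    have := (tendsto_integral_Iic_zero (f := v) (μ := volume) tendsto_id).const_mul 2
    rw [mul_zero] at this
    have h3 := (Real.continuous_exp.tendsto 0).comp this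
    rw [Real.exp_zero] at h3
    exact h3
  have hint : ∫ y in Set.Iic x, E y * (2 * v y) = E x - 1 :=
    integral_Iic_of_hasDerivAt_of_tendsto' (fun y _ => hd y)
      ((hvE.const_mul 2).congr (Eventually.of_forall fun y => by ring)).integrableOn hlim
  calc _ ≤ ∫ y, (Set.Iic x).indicator (fun y => v y * E y) y := by
        refine integral_mono_of_nonneg (Eventually.of_forall fun y => ?_)
          (hvE.indicator measurableSet_Iic) (Eventually.of_forall fun y => ?_)
        · exact mul_nonneg (norm_nonneg _) (mul_nonneg (h0 y) (zero_le_one.trans (hE1 y)))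
        · by_cases hy : y ≤ x
          · simp only [Set.indicator_of_mem (Set.mem_Iic.2 hy)]
            exact mul_le_of_le_one_left (mul_nonneg (h0 y) (zero_le_one.trans (hE1 y))) (hP _)
          · rw [Set.indicator_of_notMem (by simpa using hy)]
            simp only [hs (x - y) (by linarith [not_le.1 hy]), norm_zero, zero_mul, le_refl]
    _ = (E x - 1) / 2 := by
        rw [integral_indicator measurableSet_Iic, ← hint, ← integral_div]
        congr 1
        ext y
        ring
    _ ≤ _ := by linarith

theorem exists_weight {v : ℝ → ℝ} (hc : Continuous v) (hi : Integrable v) (h0 : ∀ x, 0 ≤ v x)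
    {P : ℝ → ℂ} (hP : ∀ x, ‖P x‖ ≤ 1)
    (hs : (∀ x < 0, P x = 0) ∨ ∀ x > 0, P x = 0) :
    ∃ E : ℝ → ℝ, Continuous E ∧ (∀ x, 1 ≤ E x) ∧ (∀ x, E x ≤ Real.exp (2 * ∫ t, v t)) ∧
      ∀ x, ∫ y, ‖P (x - y)‖ * (v y * E y) ≤ E x / 2 := by
  rcases hs with hs | hs
  · exact exists_weight_of_left hc hi h0 hP hs
  · obtain ⟨E, h1, h2, h3, h4⟩ := exists_weight_of_left (v := fun x => v (-x)) (by fun_prop)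
      hi.comp_neg (fun x => h0 _) (P := fun x => P (-x))
      (fun x => hP _) (fun x hx => hs _ (neg_pos.2 hx))
    refine ⟨fun x => E (-x), by fun_prop, fun x => h2 _, fun x => ?_, fun x => ?_⟩
    · rw [← integral_neg_eq_self]
      exact h3 _
    · refine le_trans (le_of_eq ?_) (h4 (-x))
      rw [← integral_neg_eq_self]
      congr 1
      ext y
      congr 3
      · ring
      · exact congrArg E (neg_neg y)

/-! ### The class of polynomially bounded functions -/

theorem exists_memWeightedLInfty_iff {m : ℝ → ℂ} :
    (∃ σ : ℝ, 0 < σ ∧ MemWeightedLInfty σ m) ↔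
      AEStronglyMeasurable m volume ∧ ∃ (N : ℕ) (M : ℝ), ∀ᵐ x, ‖m x‖ ≤ M * (1 + |x|) ^ N := by
  constructor
  · rintro ⟨σ, -, hm⟩
    have hpos : ∀ x : ℝ, 0 < 1 + |x| := fun x => by positivity
    refine ⟨?_, ⌈σ⌉₊, lpNorm (fun x : ℝ => (((1 + |x|) ^ (-σ) : ℝ) : ℂ) * m x) ∞ volume, ?_⟩
    · have hc : Continuous fun x : ℝ => (((1 + |x|) ^ σ : ℝ) : ℂ) :=
        continuous_ofReal.comp (Continuous.rpow_const (by fun_prop) fun x => Or.inl (hpos x).ne')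
      refine (hc.aestronglyMeasurable.mul hm.aestronglyMeasurable).congr
        (Eventually.of_forall fun x => ?_)
      simp only [Pi.mul_apply]
      rw [← mul_assoc, ← ofReal_mul, ← Real.rpow_add (hpos x), add_neg_cancel, Real.rpow_zero,
        ofReal_one, one_mul]
    · filter_upwards [ae_le_lpNorm_exponent_top hm] with x hx
      rw [norm_mul, norm_real, Real.norm_of_nonneg (by positivity), Real.rpow_neg (hpos x).le,
        inv_mul_le_iff₀ (by positivity), mul_comm] at hx
      refine hx.trans (mul_le_mul_of_nonneg_left ?_ lpNorm_nonneg)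
      rw [← Real.rpow_natCast]
      exact Real.rpow_le_rpow_of_exponent_le (by linarith [abs_nonneg x]) (Nat.le_ceil σ)
  · rintro ⟨hm, N, M, hM⟩
    have hpos : ∀ x : ℝ, 0 < 1 + |x| := fun x => by positivity
    -- The exponent is `N + 1` and not `N` because `σ` has to be positive even when `N = 0`.
    refine ⟨(N + 1 : ℕ), by positivity, memLp_top_of_bound ?_ |M| ?_⟩
    · have hc : Continuous fun x : ℝ => (((1 + |x|) ^ (-((N + 1 : ℕ) : ℝ)) : ℝ) : ℂ) :=
        continuous_ofReal.comp (Continuous.rpow_const (by fun_prop) fun x => Or.inl (hpos x).ne')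
      exact hc.aestronglyMeasurable.mul hm
    · filter_upwards [hM] with x hx
      rw [norm_mul, norm_real, Real.norm_of_nonneg (by positivity), Real.rpow_neg (hpos x).le,
        Real.rpow_natCast, inv_mul_le_iff₀ (by positivity)]
      calc _ ≤ M * (1 + |x|) ^ N := hx
        _ ≤ |M| * (1 + |x|) ^ (N + 1) := by
          gcongr
          · exact le_abs_self M
          · linarith [abs_nonneg x]
          · omega
        _ = _ := mul_comm _ _

theorem isJostSolution_iff {u : 𝓢(ℝ, ℝ)} {G g m : ℝ → ℂ} : IsJostSolution u G g m ↔
    (AEStronglyMeasurable m volume ∧ ∃ (N : ℕ) (M : ℝ), ∀ᵐ x, ‖m x‖ ≤ M * (1 + |x|) ^ N) ∧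
    ∀ᵐ x : ℝ, m x = g x + ∫ y : ℝ, G (x - y) * ((u y : ℂ) * m y) := by
  rw [IsJostSolution, exists_memWeightedLInfty_iff]

theorem integrable_and_bounded_mul (u : 𝓢(ℝ, ℝ)) {m : ℝ → ℂ} (hm : AEStronglyMeasurable m volume)
    {N : ℕ} {M : ℝ} (hM : ∀ᵐ x, ‖m x‖ ≤ M * (1 + |x|) ^ N) :
    Integrable (fun y => (u y : ℂ) * m y) ∧ ∃ B : ℝ, ∀ᵐ y, ‖(u y : ℂ) * m y‖ ≤ B := by
  -- `N` powers offset the growth of `m`; the other two produce the integrable majorant `(1 +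
  -- y²)⁻¹`.
  obtain ⟨C, hC, hu⟩ := exists_decay (complexify u) (N + 2)
  have hM0 : 0 ≤ M := by
    obtain ⟨x, hx⟩ := hM.exists
    exact nonneg_of_mul_nonneg_left ((norm_nonneg _).trans hx) (by positivity)
  have key : ∀ᵐ y, ‖(u y : ℂ) * m y‖ ≤ M * C * (1 + y ^ 2)⁻¹ := by
    filter_upwards [hM] with y hy
    have h1 := hu y
    rw [complexify_apply] at h1
    have h2 : 1 + y ^ 2 ≤ (1 + |y|) ^ 2 := by nlinarith [abs_nonneg y, sq_abs y]
    rw [norm_mul, ← div_eq_mul_inv, le_div_iff₀ (by positivity)]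
    calc _ ≤ ‖(u y : ℂ)‖ * (M * (1 + |y|) ^ N) * (1 + |y|) ^ 2 := by gcongr
      _ = M * ((1 + |y|) ^ (N + 2) * ‖(u y : ℂ)‖) := by ring
      _ ≤ _ := by gcongr
  refine ⟨(integrable_inv_one_add_sq.const_mul (M * C)).mono' ?_ key, M * C, ?_⟩
  · exact (complexify u).continuous.aestronglyMeasurable.mul hm
  · filter_upwards [key] with y hy
    refine hy.trans (mul_le_of_le_one_right (by positivity) (inv_le_one_of_one_le₀ ?_))
    nlinarith [sq_nonneg y]

theorem IsJostSolution.integrable_mul {u : 𝓢(ℝ, ℝ)} {G g m : ℝ → ℂ} (h : IsJostSolution u G g m) :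
    Integrable fun y => (u y : ℂ) * m y := by
  obtain ⟨⟨h1, N, M, hM⟩, -⟩ := isJostSolution_iff.1 h
  exact (integrable_and_bounded_mul u h1 hM).1

theorem IsJostSolution.sub {u : 𝓢(ℝ, ℝ)} {G P R g g' m m' : ℝ → ℂ} {κ : ℝ} (hG : IsSplit G P R κ)
    (h : IsJostSolution u G g m) (h' : IsJostSolution u G g' m') :
    IsJostSolution u G (g - g') (m - m') := by
  obtain ⟨⟨h1, N, M, hM⟩, h2⟩ := isJostSolution_iff.1 h
  obtain ⟨⟨h1', N', M', hM'⟩, h2'⟩ := isJostSolution_iff.1 h'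
  obtain ⟨i, B, hB⟩ := integrable_and_bounded_mul u h1 hM
  obtain ⟨i', B', hB'⟩ := integrable_and_bounded_mul u h1' hM'
  refine isJostSolution_iff.2 ⟨⟨h1.sub h1', N + N', |M| + |M'|, ?_⟩, ?_⟩
  · filter_upwards [hM, hM'] with x hx hx'
    have hx1 : 1 ≤ 1 + |x| := by linarith [abs_nonneg x]
    calc ‖(m - m') x‖ ≤ M * (1 + |x|) ^ N + M' * (1 + |x|) ^ N' :=
          (norm_sub_le _ _).trans (add_le_add hx hx')
      _ ≤ |M| * (1 + |x|) ^ (N + N') + |M'| * (1 + |x|) ^ (N + N') := by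
          gcongr
          · exact le_abs_self _
          · omega
          · exact le_abs_self _
          · omega
      _ = _ := by ring
  · filter_upwards [h2, h2'] with x hx hx'
    rw [Pi.sub_apply, Pi.sub_apply, hx, hx', add_sub_add_comm,
      ← integral_sub (hG.integrable_mul i hB x) (hG.integrable_mul i' hB' x)]
    congr 2
    ext y
    rw [Pi.sub_apply]
    ring

/-! ### Solvability for large frequency -/

/-- The constant `e^{2‖u‖₁}`, which controls the weight. -/
noncomputable def weightBound (u : 𝓢(ℝ, ℝ)) : ℝ := Real.exp (2 * ∫ t, ‖u t‖)

/-- The size of the kernel `R` relative to `κ^{-1/2}` after weighting. -/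
noncomputable def remainderBound (u : 𝓢(ℝ, ℝ)) : ℝ :=
  weightBound u * (SchwartzMap.seminorm ℝ 0 0 u * singularMass + ∫ t, ‖u t‖)

theorem weightBound_pos (u : 𝓢(ℝ, ℝ)) : 0 < weightBound u := Real.exp_pos _

/-- The one-sided part costs at most `E x / 2`. The rest costs at most 1/4, as `80 = 4 · 20`, hence
at most `E x / 4` because `E ≥ 1`. Dividing by `E x` leaves 3/4. -/
theorem IsSplit.exists_isContractive {G P R : ℝ → ℂ} {κ : ℝ} (h : IsSplit G P R κ) (u : 𝓢(ℝ, ℝ))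
    (hκ : 80 * remainderBound u ≤ √κ) :
    ∃ E : ℝ → ℝ, Continuous E ∧ (∀ x, 1 ≤ E x) ∧ (∀ x, E x ≤ weightBound u) ∧
      IsContractive (fun x y => ((E x)⁻¹ : ℝ) * (G (x - y) * ((u y : ℂ) * (E y : ℝ)))) (3 / 4) := by
  obtain ⟨E, hc, h1, hM, hE⟩ := exists_weight (v := fun x => ‖u x‖) u.continuous.norm
    u.integrable.norm (fun _ => norm_nonneg _) h.norm_left_le h.one_sided
  change ∀ x, E x ≤ weightBound u at hM
  have hE0 : ∀ x, 0 < E x := fun x => zero_lt_one.trans_le (h1 x)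
  have hcont : Continuous fun y => (u y : ℂ) * (E y : ℂ) :=
    (complexify u).continuous.mul (continuous_ofReal.comp hc)
  have hnorm : ∀ y, ‖(u y : ℂ) * (E y : ℂ)‖ = ‖u y‖ * E y := fun y => by
    rw [norm_mul, norm_real, norm_real, Real.norm_of_nonneg (hE0 y).le]
  have hle : ∀ y, ‖(u y : ℂ) * (E y : ℂ)‖ ≤ weightBound u * ‖u y‖ := fun y => by
    rw [hnorm, mul_comm]; gcongr; exact hM y
  have hint : Integrable fun y => (u y : ℂ) * (E y : ℂ) :=
    (u.integrable.norm.const_mul (weightBound u)).mono' hcont.aestronglyMeasurable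
      (Eventually.of_forall hle)
  have hb : ∀ᵐ y, ‖(u y : ℂ) * (E y : ℂ)‖ ≤ weightBound u * SchwartzMap.seminorm ℝ 0 0 u :=
    Eventually.of_forall fun y => (hle y).trans
      (mul_le_mul_of_nonneg_left (u.norm_le_seminorm ℝ y) (weightBound_pos u).le)
  refine ⟨E, hc, h1, hM, ?_, fun x => ?_, fun x => ?_, by norm_num⟩
  · have hG : AEStronglyMeasurable (fun p : ℝ × ℝ => G (p.1 - p.2)) (volume.prod volume) :=
      h.aestronglyMeasurable.comp_quasiMeasurePreserving
        (quasiMeasurePreserving_sub_of_right_invariant volume volume)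
    have hinv : Continuous fun x => (((E x)⁻¹ : ℝ) : ℂ) :=
      continuous_ofReal.comp (hc.inv₀ fun x => (hE0 x).ne')
    exact hinv.aestronglyMeasurable.comp_fst.mul (hG.mul hcont.aestronglyMeasurable.comp_snd)
  · exact (h.integrable_mul hint hb x).const_mul _
  · have e1 : ∫ y, ‖G (x - y) * ((u y : ℂ) * (E y : ℂ))‖ ≤
        E x / 2 + 20 * (√κ)⁻¹ * remainderBound u := by
      have iP := (h.integrable_left_mul hint x).norm
      have iR := (h.integrable_right_mul hint hb x).norm
      calc _ ≤ ∫ y, (‖P (x - y) * ((u y : ℂ) * (E y : ℂ))‖ +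
            ‖R (x - y) * ((u y : ℂ) * (E y : ℂ))‖) := by
            refine integral_mono_ae (h.integrable_mul hint hb x).norm (iP.add iR) ?_
            filter_upwards [h.ae_eq_add (fun y => (u y : ℂ) * (E y : ℂ)) x] with y hy
            rw [hy]
            exact norm_add_le _ _
        _ ≤ _ := by
            rw [integral_add iP iR]
            refine add_le_add ?_ ?_
            · refine le_trans (le_of_eq ?_) (hE x)
              simp only [norm_mul (P _), hnorm]
            · refine (h.integral_norm_right_mul_le hint hb x).trans ?_
              have : ∫ y, ‖(u y : ℂ) * (E y : ℂ)‖ ≤ weightBound u * ∫ t, ‖u t‖ := by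
                rw [← integral_const_mul]
                exact integral_mono hint.norm (u.integrable.norm.const_mul _) hle
              unfold remainderBound
              gcongr
              linarith
    have hsκ : 0 < √κ := Real.sqrt_pos.2 h.κ_pos
    have e2 : 20 * (√κ)⁻¹ * remainderBound u ≤ 1 / 4 := by
      rw [mul_right_comm, ← div_eq_mul_inv, div_le_iff₀ hsκ]
      linarith
    simp only [norm_mul (((E x)⁻¹ : ℝ) : ℂ), integral_const_mul, norm_real]
    rw [Real.norm_of_nonneg (inv_nonneg.2 (hE0 x).le), inv_mul_le_iff₀ (hE0 x)]
    linarith [h1 x]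

section solvability

variable {G P R : ℝ → ℂ} {κ : ℝ} (h : IsSplit G P R κ) {u : 𝓢(ℝ, ℝ)}
  (hκ : 80 * remainderBound u ≤ √κ)

include h hκ

/-- A solution of polynomial growth with bounded datum is automatically bounded, since `u r` is
bounded and integrable; so the contraction estimate applies to `r / E`. The factor 4 is `1 / (1 -
3/4)`, and `weightBound u` removes the weight. -/
theorem IsJostSolution.norm_le {g r : ℝ → ℂ} (hr : IsJostSolution u G g r) {H : ℝ}
    (hg : ∀ᵐ x, ‖g x‖ ≤ H) : ∀ᵐ x, ‖r x‖ ≤ 4 * weightBound u * H := by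
  obtain ⟨E, hc, h1, hM, hK⟩ := h.exists_isContractive u hκ
  have hE0 : ∀ x, 0 < E x := fun x => zero_lt_one.trans_le (h1 x)
  obtain ⟨⟨hm, N, M, hN⟩, heq⟩ := isJostSolution_iff.1 hr
  obtain ⟨i, B, hB⟩ := integrable_and_bounded_mul u hm hN
  have hH : 0 ≤ H := by
    obtain ⟨x, hx⟩ := hg.exists
    exact (norm_nonneg _).trans hx
  have hsmall : ∀ (z : ℂ) (x : ℝ), ‖(((E x)⁻¹ : ℝ) : ℂ) * z‖ ≤ ‖z‖ := fun z x => by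
    rw [norm_mul, norm_real, Real.norm_of_nonneg (inv_nonneg.2 (hE0 x).le)]
    exact mul_le_of_le_one_left (norm_nonneg _) (inv_le_one_of_one_le₀ (h1 x))
  have hinv : Continuous fun x => (((E x)⁻¹ : ℝ) : ℂ) :=
    continuous_ofReal.comp (hc.inv₀ fun x => (hE0 x).ne')
  have hmem : MemLp (fun x => (((E x)⁻¹ : ℝ) : ℂ) * r x) ∞ := by
    refine memLp_top_of_bound (hinv.aestronglyMeasurable.mul hm) (H + ((∫ y, ‖(u y : ℂ) * r y‖) +
      20 * (√κ)⁻¹ * (B * singularMass + ∫ y, ‖(u y : ℂ) * r y‖))) ?_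
    filter_upwards [heq, hg] with x hx hgx
    refine (hsmall _ x).trans ?_
    rw [hx]
    exact (norm_add_le _ _).trans (add_le_add hgx (h.norm_integral_mul_le i hB x))
  have hb := hK.norm_le_of_ae_eq hmem (g := fun x => (((E x)⁻¹ : ℝ) : ℂ) * g x) (H := H)
    (hg.mono fun x hx => (hsmall _ x).trans hx) (by
      filter_upwards [heq] with x hx
      have e : ∀ y, (((E x)⁻¹ : ℝ) : ℂ) * (G (x - y) * ((u y : ℂ) * (E y : ℂ))) *
          ((((E y)⁻¹ : ℝ) : ℂ) * r y) =
            (((E x)⁻¹ : ℝ) : ℂ) * (G (x - y) * ((u y : ℂ) * r y)) := fun y => by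
        have : (E y : ℂ) ≠ 0 := by exact_mod_cast (hE0 y).ne'
        push_cast
        field_simp
      simp only [e]
      rw [integral_const_mul, ← mul_add, ← hx])
  filter_upwards [hb] with x hx
  rw [norm_mul, norm_real, Real.norm_of_nonneg (inv_nonneg.2 (hE0 x).le),
    inv_mul_le_iff₀ (hE0 x)] at hx
  calc _ ≤ E x * (H / (1 - 3 / 4)) := hx
    _ ≤ weightBound u * (H / (1 - 3 / 4)) := by
        exact mul_le_mul_of_nonneg_right (hM x) (div_nonneg hH (by norm_num))
    _ = _ := by ring

theorem hasUniqueJostSolution {g : ℝ → ℂ} (hg : MemLp g ∞) : HasUniqueJostSolution u G g := by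
  obtain ⟨E, hc, h1, hM, hK⟩ := h.exists_isContractive u hκ
  have hE0 : ∀ x, 0 < E x := fun x => zero_lt_one.trans_le (h1 x)
  have hinv : Continuous fun x => (((E x)⁻¹ : ℝ) : ℂ) :=
    continuous_ofReal.comp (hc.inv₀ fun x => (hE0 x).ne')
  have hEg : MemLp (fun x => (((E x)⁻¹ : ℝ) : ℂ) * g x) ∞ := by
    refine hg.of_le (hinv.aestronglyMeasurable.mul hg.aestronglyMeasurable)
      (Eventually.of_forall fun x => ?_)
    rw [norm_mul, norm_real, Real.norm_of_nonneg (inv_nonneg.2 (hE0 x).le)]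
    exact mul_le_of_le_one_left (norm_nonneg _) (inv_le_one_of_one_le₀ (h1 x))
  obtain ⟨n, hn, heq⟩ := hK.exists_fixedPoint hEg
  have hsol : IsJostSolution u G g fun x => (E x : ℂ) * n x := by
    refine isJostSolution_iff.2 ⟨⟨(continuous_ofReal.comp hc).aestronglyMeasurable.mul
      hn.aestronglyMeasurable, 0, weightBound u * lpNorm n ∞ volume, ?_⟩, ?_⟩
    · filter_upwards [ae_le_lpNorm_exponent_top hn] with x hx
      rw [pow_zero, mul_one, norm_mul, norm_real, Real.norm_of_nonneg (hE0 x).le]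
      have := (weightBound_pos u).le
      gcongr
      exact hM x
    · filter_upwards [heq] with x hx
      rw [hx]
      simp only [mul_assoc (((E x)⁻¹ : ℝ) : ℂ)]
      rw [integral_const_mul, ← mul_add, ← mul_assoc, ← ofReal_mul, mul_inv_cancel₀ (hE0 x).ne',
        ofReal_one, one_mul]
      simp only [mul_assoc]
  refine ⟨_, hsol, fun m' hm' => ?_⟩
  -- The difference of two solutions has datum 0, so the stability bound makes it vanish.
  have := IsJostSolution.norm_le h hκ (hm'.sub h hsol) (H := 0)
    (Eventually.of_forall fun x => by simp)
  filter_upwards [this] with x hx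
  rw [mul_zero, norm_le_zero_iff, Pi.sub_apply, sub_eq_zero] at hx
  exact hx

end solvability

theorem HasUniqueJostSolution.isJostSolution {u : 𝓢(ℝ, ℝ)} {G g : ℝ → ℂ}
    (h : HasUniqueJostSolution u G g) : IsJostSolution u G g (jostSolution u G g) := by
  obtain ⟨m, hm, -⟩ := h
  have hex : ∃ m, IsJostSolution u G g m := ⟨m, hm⟩
  rw [jostSolution, dif_pos hex]
  exact hex.choose_spec

/-! ### Linearity of the transforms -/

theorem hat_add (f g : 𝓢(ℝ, ℂ)) (ξ : ℝ) : hat (f + g : 𝓢(ℝ, ℂ)) ξ = hat f ξ + hat g ξ := by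
  have hi : ∀ f : 𝓢(ℝ, ℂ), Integrable fun x : ℝ => cexp (-(I * ξ * x)) * f x := fun f => by
    simpa using integrable_cexp_sub_mul ξ 0 f
  rw [hat, hat, hat, ← integral_add (hi f) (hi g)]
  congr 1
  ext x
  rw [_root_.add_apply, mul_add]

theorem hat_smul (c : ℂ) (f : 𝓢(ℝ, ℂ)) (ξ : ℝ) : hat (c • f : 𝓢(ℝ, ℂ)) ξ = c * hat f ξ := by
  rw [hat, hat, ← integral_const_mul]
  congr 1
  ext x
  rw [_root_.smul_apply, smul_eq_mul]
  ring

theorem cauchyPlus_neg (f : 𝓢(ℝ, ℂ)) (x : ℝ) : cauchyPlus (-f : 𝓢(ℝ, ℂ)) x = -cauchyPlus f x := by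
  have h : ∀ ξ, hat (-f : 𝓢(ℝ, ℂ)) ξ = -hat f ξ := fun ξ => by
    rw [← neg_one_smul ℂ f, hat_smul, neg_one_mul]
  simp only [cauchyPlus, h, mul_neg, integral_neg]

/-! ### The asymptotic expansion of `m₁` -/

/-- The product `u C₊f` as a Schwartz function. -/
noncomputable def mulCauchyPlus (u : 𝓢(ℝ, ℝ)) (f : 𝓢(ℝ, ℂ)) : 𝓢(ℝ, ℂ) :=
  SchwartzMap.smulLeftCLM ℂ (cauchyPlus f) (complexify u)

theorem mulCauchyPlus_apply (u : 𝓢(ℝ, ℝ)) (f : 𝓢(ℝ, ℂ)) (x : ℝ) :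
    mulCauchyPlus u f x = (u x : ℂ) * cauchyPlus f x := by
  rw [mulCauchyPlus, SchwartzMap.smulLeftCLM_apply_apply (hasTemperateGrowth_cauchyPlus f),
    smul_eq_mul, mul_comm, complexify_apply]

/-- The Schwartz functions whose Cauchy projections are the coefficients of the expansion of `m₁`
in powers of `1 / k`. -/
noncomputable def expansionCoeff (u : 𝓢(ℝ, ℝ)) : ℕ → 𝓢(ℝ, ℂ)
  | 0 => -complexify u
  | n + 1 => opD (expansionCoeff u n) - mulCauchyPlus u (expansionCoeff u n)

/-- The truncated expansion of `m₁` in powers of `1 / k`. -/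
noncomputable def expansion (u : 𝓢(ℝ, ℝ)) (k : ℂ) : ℕ → ℝ → ℂ
  | 0 => fun _ => 1
  | n + 1 => fun x => expansion u k n x + k⁻¹ ^ (n + 1) * cauchyPlus (expansionCoeff u n) x

/-- The product of `u` with the truncated expansion, as a Schwartz function. -/
noncomputable def mulExpansion (u : 𝓢(ℝ, ℝ)) (k : ℂ) : ℕ → 𝓢(ℝ, ℂ)
  | 0 => complexify u
  | n + 1 => mulExpansion u k n + k⁻¹ ^ (n + 1) • mulCauchyPlus u (expansionCoeff u n)

theorem mulExpansion_apply (u : 𝓢(ℝ, ℝ)) (k : ℂ) (n : ℕ) (x : ℝ) :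
    mulExpansion u k n x = (u x : ℂ) * expansion u k n x := by
  induction n with
  | zero => simp [mulExpansion, expansion, complexify_apply]
  | succ n ih =>
    rw [mulExpansion, expansion, _root_.add_apply, _root_.smul_apply, ih,
      mulCauchyPlus_apply, smul_eq_mul]
    ring

theorem continuous_expansion (u : 𝓢(ℝ, ℝ)) (k : ℂ) (n : ℕ) : Continuous (expansion u k n) := by
  induction n with
  | zero => exact continuous_const
  | succ n ih =>
    have := (hasTemperateGrowth_cauchyPlus (expansionCoeff u n)).1.continuous
    rw [expansion]
    fun_prop

theorem exists_norm_expansion_le (u : 𝓢(ℝ, ℝ)) (k : ℂ) (n : ℕ) :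
    ∃ M, ∀ x, ‖expansion u k n x‖ ≤ M := by
  induction n with
  | zero => exact ⟨1, fun x => by simp [expansion]⟩
  | succ n ih =>
    obtain ⟨M, hM⟩ := ih
    refine ⟨M + ‖k⁻¹ ^ (n + 1)‖ * ∫ ξ, ‖hat (expansionCoeff u n) ξ‖, fun x => ?_⟩
    rw [expansion]
    refine (norm_add_le _ _).trans (add_le_add (hM x) ?_)
    rw [norm_mul]
    gcongr
    exact norm_cauchyPlus_le _ _

theorem CutPlane.integral_kernel_mul_expansion (u : 𝓢(ℝ, ℝ)) (k : CutPlane) (n : ℕ) (x : ℝ) :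
    ∫ y, k.kernel (x - y) * mulExpansion u k.val n y = expansion u k.val n x - 1 -
      k.val⁻¹ ^ n * ∫ y, k.kernel (x - y) * expansionCoeff u n y := by
  obtain ⟨P, R, hs⟩ := k.exists_isSplit
  have hi : ∀ f : 𝓢(ℝ, ℂ), Integrable fun y => k.kernel (x - y) * f y := fun f =>
    hs.integrable_mul f.integrable (ae_norm_schwartz_le f) x
  have hk : k.val ≠ 0 := norm_pos_iff.1 hs.κ_pos
  induction n with
  | zero =>
    simp only [mulExpansion, expansion, expansionCoeff, _root_.neg_apply, mul_neg,
      integral_neg]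
    ring
  | succ n ih =>
    -- By the recursion `u C₊f_n = D f_n - f_{n+1}`. The `D` identity turns `k^{-(n+1)} G * D f_n`
    -- into `k^{-n} G * f_n`, which cancels the old remainder, plus the next term of the expansion;
    -- `f_{n+1}` carries the new remainder.
    have e1 : ∀ y, k.kernel (x - y) * mulExpansion u k.val (n + 1) y =
        k.kernel (x - y) * mulExpansion u k.val n y + k.val⁻¹ ^ (n + 1) *
          (k.kernel (x - y) * opD (expansionCoeff u n) y -
            k.kernel (x - y) * expansionCoeff u (n + 1) y) := fun y => by
      simp only [mulExpansion, expansionCoeff, _root_.add_apply, _root_.smul_apply,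
        _root_.sub_apply, smul_eq_mul]
      ring
    simp only [e1]
    have hd : Integrable fun y => k.val⁻¹ ^ (n + 1) * (k.kernel (x - y) *
        opD (expansionCoeff u n) y - k.kernel (x - y) * expansionCoeff u (n + 1) y) :=
      ((hi _).sub (hi _)).const_mul _
    rw [integral_add (hi _) hd, integral_const_mul, integral_sub (hi _) (hi _), ih, CutPlane.integral_kernel_mul_opD, expansion, pow_succ]
    field_simp
    ring

theorem isJostSolution_expansion (u : 𝓢(ℝ, ℝ)) (k : CutPlane) (n : ℕ) :
    IsJostSolution u k.kernel
      (fun x => 1 + k.val⁻¹ ^ n * ∫ y, k.kernel (x - y) * expansionCoeff u n y)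
      (expansion u k.val n) := by
  obtain ⟨M, hM⟩ := exists_norm_expansion_le u k.val n
  refine isJostSolution_iff.2 ⟨⟨(continuous_expansion u k.val n).aestronglyMeasurable, 0, M,
    Eventually.of_forall fun x => by simpa using hM x⟩, Eventually.of_forall fun x => ?_⟩
  simp only [← mulExpansion_apply]
  rw [CutPlane.integral_kernel_mul_expansion]
  ring

/-- A bound for the convolution of a Schwartz function with any split kernel with `κ ≥ 1`. -/
noncomputable def convBound (f : 𝓢(ℝ, ℂ)) : ℝ :=
  (∫ y, ‖f y‖) + 20 * (SchwartzMap.seminorm ℝ 0 0 f * singularMass + ∫ y, ‖f y‖)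

theorem convBound_nonneg (f : 𝓢(ℝ, ℂ)) : 0 ≤ convBound f := by
  have h1 : 0 ≤ ∫ y, ‖f y‖ := integral_nonneg fun _ => norm_nonneg _
  have h2 : 0 ≤ SchwartzMap.seminorm ℝ 0 0 f := apply_nonneg _ _
  have h3 := singularMass_nonneg
  unfold convBound
  positivity

theorem IsSplit.norm_integral_mul_le_convBound {G P R : ℝ → ℂ} {κ : ℝ} (h : IsSplit G P R κ)
    (hκ : 1 ≤ κ) (f : 𝓢(ℝ, ℂ)) (x : ℝ) : ‖∫ y, G (x - y) * f y‖ ≤ convBound f := by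
  refine (h.norm_integral_mul_le f.integrable (ae_norm_schwartz_le f) x).trans ?_
  have h1 : 0 ≤ ∫ y, ‖f y‖ := integral_nonneg fun _ => norm_nonneg _
  have h2 : 0 ≤ SchwartzMap.seminorm ℝ 0 0 f := apply_nonneg _ _
  have h3 := singularMass_nonneg
  have h4 : (√κ)⁻¹ ≤ 1 := inv_le_one_of_one_le₀ (Real.one_le_sqrt.2 hκ)
  unfold convBound
  gcongr
  exact mul_le_of_le_one_right (by norm_num) h4

theorem norm_m₁_sub_expansion_le (u : 𝓢(ℝ, ℝ)) (n : ℕ) (k : CutPlane) (hk : 1 ≤ ‖k.val‖)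
    (hk' : 80 * remainderBound u ≤ √‖k.val‖) :
    ∀ᵐ x, ‖m₁ u k x - expansion u k.val n x‖ ≤
      4 * weightBound u * convBound (expansionCoeff u n) / ‖k.val‖ ^ n := by
  obtain ⟨P, R, hs⟩ := k.exists_isSplit
  have hm : IsJostSolution u k.kernel (fun _ => 1) (m₁ u k) :=
    (hasUniqueJostSolution hs hk' (memLp_top_const 1)).isJostSolution
  have h := (hm.sub hs (isJostSolution_expansion u k n)).norm_le hs hk'
    (H := convBound (expansionCoeff u n) / ‖k.val‖ ^ n) (Eventually.of_forall fun x => by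
      rw [Pi.sub_apply, sub_add_cancel_left, norm_neg, norm_mul, norm_pow, norm_inv, inv_pow,
        inv_mul_eq_div]
      gcongr
      exact hs.norm_integral_mul_le_convBound hk _ x)
  filter_upwards [h] with x hx
  rw [mul_div_assoc]
  exact hx

theorem exists_norm_m₁_sub_le (u : 𝓢(ℝ, ℝ)) : ∃ C : ℝ, 0 < C ∧ ∀ k : CutPlane, 1 ≤ ‖k.val‖ →
    80 * remainderBound u ≤ √‖k.val‖ → ∀ᵐ x,
      ‖m₁ u k x - 1 + cauchyPlus (fun y => (u y : ℂ)) x / k.val‖ ≤ C / ‖k.val‖ ^ 2 := by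
  have hw := (weightBound_pos u).le
  have hcb := convBound_nonneg (expansionCoeff u 2)
  have hi : 0 ≤ ∫ ξ, ‖hat (expansionCoeff u 1) ξ‖ := integral_nonneg fun _ => norm_nonneg _
  refine ⟨4 * weightBound u * convBound (expansionCoeff u 2) +
    (∫ ξ, ‖hat (expansionCoeff u 1) ξ‖) + 1, by positivity, fun k hk hk' => ?_⟩
  -- Order 1 would only give an error `O(1/|k|)`. One more term is taken, and that term is itself
  -- `O(|k|^{-2})` because `C₊f_1` is bounded.
  filter_upwards [norm_m₁_sub_expansion_le u 2 k hk hk'] with x hx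
  have e : m₁ u k x - 1 + cauchyPlus (fun y => (u y : ℂ)) x / k.val =
      (m₁ u k x - expansion u k.val 2 x) + k.val⁻¹ ^ 2 * cauchyPlus (expansionCoeff u 1) x := by
    have e0 : cauchyPlus (expansionCoeff u 0) x = -cauchyPlus (fun y => (u y : ℂ)) x :=
      cauchyPlus_neg _ _
    simp only [expansion, e0]
    ring
  rw [e]
  calc _ ≤ 4 * weightBound u * convBound (expansionCoeff u 2) / ‖k.val‖ ^ 2 +
        (∫ ξ, ‖hat (expansionCoeff u 1) ξ‖) / ‖k.val‖ ^ 2 := by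
        refine (norm_add_le _ _).trans (add_le_add hx ?_)
        rw [norm_mul, norm_pow, norm_inv, inv_pow, inv_mul_eq_div]
        gcongr
        exact norm_cauchyPlus_le _ _
    _ ≤ _ := by
        rw [← add_div]
        exact div_le_div_of_nonneg_right (by linarith) (by positivity)

/-! ### Rapid decay of `β` -/

theorem exists_norm_hat_le (f : 𝓢(ℝ, ℂ)) (N : ℕ) :
    ∃ C : ℝ, 0 < C ∧ ∀ l : ℝ, 1 ≤ l → ‖hat f l‖ ≤ C / l ^ N := by
  obtain ⟨C, hC, h⟩ := exists_hat_decay f N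
  refine ⟨C, hC, fun l hl => ?_⟩
  rw [le_div_iff₀ (by positivity), mul_comm]
  refine le_trans ?_ (h l)
  gcongr
  rw [abs_of_pos (by linarith)]
  linarith

/-- The function depends on `l`, but only through coefficients `l^{-j}`, at most 1, in front of
fixed Schwartz functions. -/
theorem exists_norm_hat_mulExpansion_le (u : 𝓢(ℝ, ℝ)) (n N : ℕ) :
    ∃ C : ℝ, 0 < C ∧ ∀ l : ℝ, 1 ≤ l → ‖hat (mulExpansion u (l : ℂ) n) l‖ ≤ C / l ^ N := by
  induction n with
  | zero => exact exists_norm_hat_le (complexify u) N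
  | succ n ih =>
    obtain ⟨C, hC, h⟩ := ih
    obtain ⟨C', hC', h'⟩ := exists_norm_hat_le (mulCauchyPlus u (expansionCoeff u n)) N
    refine ⟨C + C', by positivity, fun l hl => ?_⟩
    rw [mulExpansion, hat_add, hat_smul, add_div]
    refine (norm_add_le _ _).trans (add_le_add (h l hl) ?_)
    rw [norm_mul, norm_pow, norm_inv, norm_real, Real.norm_of_nonneg (by linarith)]
    refine (mul_le_of_le_one_left (norm_nonneg _) ?_).trans (h' l hl)
    exact pow_le_one₀ (by positivity) (inv_le_one_of_one_le₀ hl)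

/-- Perturbing `m` by `D` in `L^∞` perturbs `∫ u m e^{-ilx}` by at most `‖u‖₁ D`. -/
theorem norm_integral_sub_integral_le (u : 𝓢(ℝ, ℝ)) {m a : ℝ → ℂ} {D : ℝ} (l : ℝ)
    (hm : Integrable fun x => (u x : ℂ) * m x) (ha : Integrable fun x => (u x : ℂ) * a x)
    (h : ∀ᵐ x, ‖m x - a x‖ ≤ D) :
    ‖(∫ x : ℝ, (u x : ℂ) * m x * cexp (-(I * l * x))) -
      ∫ x : ℝ, (u x : ℂ) * a x * cexp (-(I * l * x))‖ ≤ (∫ x, ‖u x‖) * D := by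
  have hn : ∀ x : ℝ, ‖cexp (-(I * l * x))‖ = 1 := fun x => by
    have := norm_cexp_I_mul_mul l (-x)
    rwa [ofReal_neg, mul_neg] at this
  have hi : ∀ f : ℝ → ℂ, Integrable f → Integrable fun x : ℝ => f x * cexp (-(I * l * x)) :=
    fun f hf => hf.mul_bdd (c := 1) (Continuous.aestronglyMeasurable (by fun_prop))
      (Eventually.of_forall fun x => (hn x).le)
  rw [← integral_sub (hi _ hm) (hi _ ha), ← integral_mul_const]
  refine norm_integral_le_of_norm_le (u.integrable.norm.mul_const D) ?_
  filter_upwards [h] with x hx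
  rw [← sub_mul, ← mul_sub, norm_mul, norm_mul, hn, mul_one, norm_real]
  gcongr

/-- The order of the expansion is matched to the desired decay: stability gives an error
`O(l^{-N})`, and the expansion itself contributes a Fourier transform at `l`. -/
theorem exists_norm_scatteringβ_le (u : 𝓢(ℝ, ℝ)) (N : ℕ) : ∃ C : ℝ, 0 < C ∧ ∀ l : ℝ, 1 ≤ l →
    80 * remainderBound u ≤ √l → ‖scatteringβ u l‖ ≤ C / l ^ N := by
  obtain ⟨C, hC, h⟩ := exists_norm_hat_mulExpansion_le u N N
  set D := 4 * weightBound u * convBound (expansionCoeff u N) with hD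
  have hD0 : 0 ≤ D :=
    mul_nonneg (mul_nonneg (by norm_num) (weightBound_pos u).le) (convBound_nonneg _)
  have hu0 : 0 ≤ ∫ x, ‖u x‖ := integral_nonneg fun _ => norm_nonneg _
  refine ⟨(∫ x, ‖u x‖) * D + C, by positivity, fun l hl hl' => ?_⟩
  have hl0 : 0 < l := by linarith
  have hv : ‖(CutPlane.above l hl0).val‖ = l := by
    rw [CutPlane.val, norm_real, Real.norm_of_nonneg hl0.le]
  have h1 := norm_m₁_sub_expansion_le u N (.above l hl0) (by rwa [hv]) (by rwa [hv])
  rw [hv, m₁_above, ← hD] at h1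
  obtain ⟨P, R, hs⟩ := (CutPlane.above l hl0).exists_isSplit
  have hm := (hasUniqueJostSolution hs (by rwa [hv]) (memLp_top_const 1)).isJostSolution
  have h2 := norm_integral_sub_integral_le u l hm.integrable_mul
    (isJostSolution_expansion u (.above l hl0) N).integrable_mul h1
  have e : ∫ x : ℝ, (u x : ℂ) * expansion u (l : ℂ) N x * cexp (-(I * l * x)) =
      hat (mulExpansion u (l : ℂ) N) l := by
    simp only [hat, mulExpansion_apply]
    congr 1
    ext x
    ring
  change ‖(∫ x : ℝ, (u x : ℂ) * m₁Plus u l x * cexp (-(I * l * x))) -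
    ∫ x : ℝ, (u x : ℂ) * expansion u (l : ℂ) N x * cexp (-(I * l * x))‖ ≤ _ at h2
  rw [e] at h2
  rw [scatteringβ, norm_mul, norm_I, one_mul, add_div, mul_div_assoc]
  refine (norm_le_norm_sub_add _ (hat (mulExpansion u (l : ℂ) N) l)).trans ?_
  exact add_le_add h2 (h l hl)

/-! ### The asymptotics of `m_e` -/

/-- The gauge factor `e^{i ∫_{-∞}^x u}`. -/
noncomputable def gauge (u : 𝓢(ℝ, ℝ)) (x : ℝ) : ℂ :=
  cexp (I * ((∫ t in Set.Iic x, u t : ℝ) : ℂ))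

theorem norm_gauge (u : 𝓢(ℝ, ℝ)) (x : ℝ) : ‖gauge u x‖ = 1 := norm_exp_I_mul_ofReal _

theorem hasTemperateGrowth_gauge (u : 𝓢(ℝ, ℝ)) : Function.HasTemperateGrowth (gauge u) := by
  have := (hasTemperateGrowth_cexp_I_mul 1).comp (hasTemperateGrowth_integral_Iic u)
  simp only [Function.comp_def, ofReal_one, mul_one] at this
  exact this

theorem hasDerivAt_gauge (u : 𝓢(ℝ, ℝ)) (x : ℝ) :
    HasDerivAt (gauge u) (I * ((u x : ℂ) * gauge u x)) x := by
  have h := ((hasDerivAt_integral_Iic u.continuous u.integrable x).ofReal_comp.const_mul I).cexp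
  refine h.congr_deriv ?_
  rw [gauge]
  ring

/-- The Schwartz function `u e^{i ∫_{-∞}^x u}`. -/
noncomputable def mulGauge (u : 𝓢(ℝ, ℝ)) : 𝓢(ℝ, ℂ) :=
  SchwartzMap.smulLeftCLM ℂ (gauge u) (complexify u)

theorem mulGauge_apply (u : 𝓢(ℝ, ℝ)) (x : ℝ) : mulGauge u x = (u x : ℂ) * gauge u x := by
  rw [mulGauge, SchwartzMap.smulLeftCLM_apply_apply (hasTemperateGrowth_gauge u), smul_eq_mul,
    mul_comm, complexify_apply]

/-- The Schwartz function `u e^{ilx} e^{i ∫_{-∞}^x u}`. -/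
noncomputable def mulGaugeWave (u : 𝓢(ℝ, ℝ)) (l : ℝ) : 𝓢(ℝ, ℂ) :=
  SchwartzMap.smulLeftCLM ℂ (planeWave l) (mulGauge u)

theorem mulGaugeWave_apply (u : 𝓢(ℝ, ℝ)) (l x : ℝ) :
    mulGaugeWave u l x = planeWave l x * mulGauge u x :=
  SchwartzMap.smulLeftCLM_apply_apply (hasTemperateGrowth_cexp_I_mul l) _ _

theorem hat_mulGaugeWave (u : 𝓢(ℝ, ℝ)) (l ξ : ℝ) :
    hat (mulGaugeWave u l) ξ = hat (mulGauge u) (ξ - l) := by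
  rw [hat, hat]
  congr 1
  ext x
  rw [mulGaugeWave_apply, planeWave, ← mul_assoc, ← Complex.exp_add]
  congr 2
  push_cast
  ring

theorem tendsto_gauge_atBot (u : 𝓢(ℝ, ℝ)) : Tendsto (gauge u) atBot (𝓝 1) := by
  have h := tendsto_integral_Iic_zero (f := u) (μ := volume) tendsto_id
  have hc : Continuous fun t : ℝ => cexp (I * t) := by fun_prop
  have := (hc.tendsto 0).comp h
  rw [ofReal_zero, mul_zero, Complex.exp_zero] at this
  exact this

theorem tendsto_gauge_atTop (u : 𝓢(ℝ, ℝ)) :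
    Tendsto (gauge u) atTop (𝓝 (cexp (I * ((∫ t : ℝ, u t : ℝ) : ℂ)))) := by
  have h : Tendsto (fun x => ∫ t in Set.Iic x, u t) atTop (𝓝 (∫ t : ℝ, u t)) :=
    (aecover_Iic tendsto_id).integral_tendsto_of_countably_generated u.integrable
  have hc : Continuous fun t : ℝ => cexp (I * t) := by fun_prop
  exact (hc.tendsto _).comp h

theorem integrable_mul_gauge (u : 𝓢(ℝ, ℝ)) : Integrable fun y => I * ((u y : ℂ) * gauge u y) := by
  refine ((mulGauge u).integrable.const_mul I).congr (Eventually.of_forall fun y => ?_)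
  simp only [mulGauge_apply]

/-- Since `e^{il(x-y)} e^{ily} = e^{ilx}`, the oscillation factors out and the derivative of `gauge
u` is left to integrate from `-∞`, where the gauge tends to 1. -/
theorem integral_residue_mulGaugeWave (u : 𝓢(ℝ, ℝ)) (l x : ℝ) :
    ∫ y, (Set.Ioi (0 : ℝ)).indicator (fun y : ℝ => I * cexp (I * (l : ℂ) * y)) (x - y) *
      mulGaugeWave u l y = planeWave l x * gauge u x - planeWave l x := by
  have h := integral_Iic_of_hasDerivAt_of_tendsto' (fun y (_ : y ∈ Set.Iic x) =>
    hasDerivAt_gauge u y) (integrable_mul_gauge u).integrableOn (tendsto_gauge_atBot u)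
  rw [integral_indicator_Ioi_sub_mul, ← mul_sub_one, ← h, ← integral_const_mul]
  congr 1
  ext y
  rw [mulGaugeWave_apply, mulGauge_apply, planeWave, planeWave,
    show I * (l : ℂ) * x = I * l * ((x - y : ℝ) : ℂ) + I * l * y by push_cast; ring,
    Complex.exp_add]
  ring

theorem isJostSolution_gauge (u : 𝓢(ℝ, ℝ)) {l : ℝ} (hl : 0 < l) :
    IsJostSolution u (kernelAbove l)
      (planeWave l - fun x => ∫ y, kernelG (-(l : ℂ)) (-(x - y)) * mulGaugeWave u l y)
      (fun x => planeWave l x * gauge u x) := by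
  have hc : Continuous fun x => planeWave l x * gauge u x :=
    ((hasTemperateGrowth_cexp_I_mul l).1.continuous).mul (hasTemperateGrowth_gauge u).1.continuous
  refine isJostSolution_iff.2 ⟨⟨hc.aestronglyMeasurable, 0, 1, Eventually.of_forall fun x => ?_⟩,
    Eventually.of_forall fun x => ?_⟩
  · rw [norm_mul, norm_gauge, planeWave, norm_cexp_I_mul_mul]
    simp
  · have hs := isSplit_above (k := (l : ℂ)) (by simpa using hl) (by simp)
      fun x hx => kernelAbove_eq hl hx
    have e : ∀ y, (u y : ℂ) * (planeWave l y * gauge u y) = mulGaugeWave u l y := fun y => by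
      rw [mulGaugeWave_apply, mulGauge_apply]
      ring
    simp only [e]
    rw [hs.integral_mul (mulGaugeWave u l).integrable (ae_norm_schwartz_le _),
      integral_residue_mulGaugeWave, Pi.sub_apply]
    ring

/-- Only frequencies `ξ ≤ 0` enter, where `|ξ - l| = |ξ| + l`. Of the `N + 2` powers of decay, `N`
give `l^{-N}` and two give `(1 + ξ²)⁻¹`, whose integral is the factor `π`. -/
theorem exists_norm_remainder_le (u : 𝓢(ℝ, ℝ)) (N : ℕ) : ∃ C : ℝ, 0 < C ∧ ∀ l : ℝ, 1 ≤ l → ∀ x,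
    ‖∫ y, kernelG (-(l : ℂ)) (-(x - y)) * mulGaugeWave u l y‖ ≤ C / l ^ N := by
  obtain ⟨C, hC, h⟩ := exists_hat_decay (mulGauge u) (N + 2)
  refine ⟨C * Real.pi, mul_pos hC Real.pi_pos, fun l hl x => ?_⟩
  have hl0 : 0 < l := by linarith
  rw [integral_kernelG_neg_mul_schwartz _ _ _ hl0, norm_neg, norm_mul]
  refine (mul_le_of_le_one_left (norm_nonneg _) AwayFromCut.norm_one_div_two_pi_le).trans ?_
  have key : ∀ ξ ∈ Set.Iic (0 : ℝ),
      ‖cexp (I * x * ξ) * hat (mulGaugeWave u l) ξ / ((ξ : ℂ) - l)‖ ≤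
        C / l ^ N * (1 + ξ ^ 2)⁻¹ := by
    intro ξ hξ
    have hξ0 : ξ ≤ 0 := hξ
    have habs : |ξ - l| = -ξ + l := by rw [abs_of_nonpos (by linarith)]; ring
    have h1 : 1 ≤ ‖(ξ : ℂ) - l‖ := by
      rw [← ofReal_sub, norm_real, Real.norm_eq_abs, habs]
      linarith
    rw [norm_div, norm_mul, norm_cexp_I_mul_mul, one_mul, hat_mulGaugeWave]
    refine (div_le_self (norm_nonneg _) h1).trans ?_
    rw [← div_eq_mul_inv, div_div, le_div_iff₀ (by positivity), mul_comm]
    refine le_trans ?_ (h (ξ - l))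
    have h2 : l ^ N ≤ (1 + (-ξ + l)) ^ N := by gcongr; linarith
    have h3 : 1 + ξ ^ 2 ≤ (1 + (-ξ + l)) ^ 2 := by nlinarith
    have h4 : 0 ≤ (1 + (-ξ + l)) ^ N := le_trans (by positivity) h2
    rw [habs, pow_add]
    gcongr
  refine (norm_integral_le_of_norm_le (integrable_inv_one_add_sq.const_mul _).integrableOn
    ((ae_restrict_mem measurableSet_Iic).mono key)).trans ?_
  calc _ ≤ ∫ ξ : ℝ, C / l ^ N * (1 + ξ ^ 2)⁻¹ :=
        setIntegral_le_integral (integrable_inv_one_add_sq.const_mul _)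
          (Eventually.of_forall fun ξ => by positivity)
    _ = _ := by
        rw [integral_const_mul, integral_univ_inv_one_add_sq]
        ring

theorem memLp_planeWave (l : ℝ) : MemLp (planeWave l) ∞ :=
  memLp_top_of_bound (hasTemperateGrowth_cexp_I_mul l).1.continuous.aestronglyMeasurable 1
    (Eventually.of_forall fun x => (norm_cexp_I_mul_mul l x).le)

theorem hasUniqueJostSolution_planeWave (u : 𝓢(ℝ, ℝ)) {l : ℝ} (hl : 0 < l)
    (hl' : 80 * remainderBound u ≤ √l) :
    HasUniqueJostSolution u (kernelAbove l) (planeWave l) := by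
  obtain ⟨P, R, hs⟩ := (CutPlane.above l hl).exists_isSplit
  refine hasUniqueJostSolution hs ?_ (memLp_planeWave l)
  rwa [CutPlane.val, norm_real, Real.norm_of_nonneg hl.le]

theorem exists_norm_mePlus_sub_le (u : 𝓢(ℝ, ℝ)) (N : ℕ) : ∃ C : ℝ, 0 < C ∧ ∀ l : ℝ, 1 ≤ l →
    80 * remainderBound u ≤ √l →
      ∀ᵐ x, ‖mePlus u l x - planeWave l x * gauge u x‖ ≤ C / l ^ N := by
  obtain ⟨C, hC, h⟩ := exists_norm_remainder_le u N
  have hw := weightBound_pos u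
  refine ⟨4 * weightBound u * C, by positivity, fun l hl hl' => ?_⟩
  have hl0 : 0 < l := by linarith
  obtain ⟨P, R, hs⟩ := (CutPlane.above l hl0).exists_isSplit
  have hv : ‖(CutPlane.above l hl0).val‖ = l := by
    rw [CutPlane.val, norm_real, Real.norm_of_nonneg hl0.le]
  rw [hv] at hs
  have hm := (hasUniqueJostSolution_planeWave u hl0 hl').isJostSolution
  have := (hm.sub hs (isJostSolution_gauge u hl0)).norm_le hs hl' (H := C / l ^ N)
    (Eventually.of_forall fun x => by
      rw [sub_sub_cancel]
      exact h l hl x)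
  filter_upwards [this] with x hx
  rw [mul_div_assoc]
  exact hx

/-- The plane waves cancel, and `i u e^{i∫u}` is the derivative of the gauge, which runs from 1 at
`-∞` to `e^{i∫_ℝ u}` at `+∞`. -/
theorem scatteringΓ_leading (u : 𝓢(ℝ, ℝ)) (l : ℝ) :
    1 + I * ∫ x : ℝ, (u x : ℂ) * (planeWave l x * gauge u x) * cexp (-(I * l * x)) =
      cexp (I * ((∫ t : ℝ, u t : ℝ) : ℂ)) := by
  have h := integral_of_hasDerivAt_of_tendsto (hasDerivAt_gauge u) (integrable_mul_gauge u)
    (tendsto_gauge_atBot u) (tendsto_gauge_atTop u)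
  rw [integral_const_mul] at h
  rw [← add_sub_cancel 1 (cexp (I * ((∫ t : ℝ, u t : ℝ) : ℂ))), ← h]
  congr 3
  ext x
  rw [planeWave, mul_comm (cexp _) (gauge u x), ← mul_assoc, mul_assoc _ (cexp _),
    ← Complex.exp_add, add_neg_cancel, Complex.exp_zero, mul_one]

theorem norm_scatteringΓ_sub_le (u : 𝓢(ℝ, ℝ)) {l D : ℝ} (hl : 0 < l)
    (hl' : 80 * remainderBound u ≤ √l)
    (h : ∀ᵐ x, ‖mePlus u l x - planeWave l x * gauge u x‖ ≤ D) :
    ‖scatteringΓ u l - cexp (I * ((∫ t : ℝ, u t : ℝ) : ℂ))‖ ≤ (∫ x, ‖u x‖) * D := by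
  have hm := (hasUniqueJostSolution_planeWave u hl hl').isJostSolution
  rw [← scatteringΓ_leading u l, scatteringΓ, add_sub_add_left_eq_sub, ← mul_sub, norm_mul, norm_I,
    one_mul]
  exact norm_integral_sub_integral_le u l hm.integrable_mul
    (isJostSolution_gauge u hl).integrable_mul h

/-! ### Assembly of the theorem -/

theorem eLpNorm_top_le_of_ae_bound {f : ℝ → ℂ} {C : ℝ} (h : ∀ᵐ x, ‖f x‖ ≤ C) :
    eLpNorm f ∞ volume ≤ ENNReal.ofReal C := by
  rw [eLpNorm_exponent_top]
  exact eLpNormEssSup_le_of_ae_bound h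

end BenjaminOno

theorem theorem6p5 (u : 𝓢(ℝ, ℝ)) :
    ∃ k₀ : ℝ, 0 < k₀ ∧ ∃ C : ℝ, 0 < C ∧
      (∀ k : BenjaminOno.CutPlane, k₀ < ‖k.val‖ →
        BenjaminOno.HasUniqueJostSolution u k.kernel (fun _ => 1) ∧
        eLpNorm (fun x : ℝ => BenjaminOno.m₁ u k x - 1
            + BenjaminOno.cauchyPlus (fun y => (u y : ℂ)) x / k.val) ∞ volume
          ≤ ENNReal.ofReal (C / ‖k.val‖ ^ 2)) ∧
      (∀ l : ℝ, k₀ < l →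
        BenjaminOno.HasUniqueJostSolution u (BenjaminOno.kernelAbove l)
          (BenjaminOno.planeWave l)) ∧
      ∀ N : ℕ, 0 < N → ∃ CN : ℝ, 0 < CN ∧ ∀ l : ℝ, k₀ < l →
        eLpNorm (fun x : ℝ => BenjaminOno.mePlus u l x
            - cexp (I * l * x) * cexp (I * ((∫ t in Set.Iic x, u t : ℝ) : ℂ))) ∞ volume
          ≤ ENNReal.ofReal (CN / l ^ N) ∧
        ‖BenjaminOno.scatteringΓ u l - cexp (I * ((∫ t : ℝ, u t : ℝ) : ℂ))‖ ≤ CN / l ^ N ∧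
        ‖BenjaminOno.scatteringβ u l‖ ≤ CN / l ^ N := by
  obtain ⟨C, hC, hm₁⟩ := BenjaminOno.exists_norm_m₁_sub_le u
  -- The 1 makes `|k| ≥ 1`, needed for bounds uniform in `k`; the square gives the contraction
  -- condition `80 * remainderBound u ≤ √|k|`.
  set k₀ : ℝ := 1 + (80 * BenjaminOno.remainderBound u) ^ 2 with hk₀
  have hpos : 0 < k₀ := by positivity
  have hone : ∀ t : ℝ, k₀ < t → 1 ≤ t := fun t ht => by
    nlinarith [sq_nonneg (80 * BenjaminOno.remainderBound u)]
  have hsqrt : ∀ t : ℝ, k₀ < t → 80 * BenjaminOno.remainderBound u ≤ √t := fun t ht =>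
    (le_abs_self _).trans (Real.abs_le_sqrt (by linarith))
  refine ⟨k₀, hpos, C, hC, fun k hk => ⟨?_, ?_⟩, fun l hl => ?_, fun N _ => ?_⟩
  · obtain ⟨P, R, hs⟩ := k.exists_isSplit
    exact BenjaminOno.hasUniqueJostSolution hs (hsqrt _ hk) (memLp_top_const 1)
  · exact BenjaminOno.eLpNorm_top_le_of_ae_bound (hm₁ k (hone _ hk) (hsqrt _ hk))
  · exact BenjaminOno.hasUniqueJostSolution_planeWave u (hpos.trans hl) (hsqrt _ hl)
  · obtain ⟨A, hA, hme⟩ := BenjaminOno.exists_norm_mePlus_sub_le u N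
    obtain ⟨B, hB, hβ⟩ := BenjaminOno.exists_norm_scatteringβ_le u N
    have hu0 : 0 ≤ ∫ x, ‖u x‖ := integral_nonneg fun _ => norm_nonneg _
    have huA : 0 ≤ (∫ x, ‖u x‖) * A := by positivity
    refine ⟨A + (∫ x, ‖u x‖) * A + B, by positivity, fun l hl => ?_⟩
    have hl0 : 0 < l := hpos.trans hl
    have h := hme l (hone _ hl) (hsqrt _ hl)
    refine ⟨?_, ?_, ?_⟩
    · refine (BenjaminOno.eLpNorm_top_le_of_ae_bound h).trans (ENNReal.ofReal_le_ofReal ?_)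
      gcongr
      linarith
    · refine (BenjaminOno.norm_scatteringΓ_sub_le u hl0 (hsqrt _ hl) h).trans ?_
      rw [← mul_div_assoc]
      gcongr
      linarith
    · refine (hβ l (hone _ hl) (hsqrt _ hl)).trans ?_
      gcongr
      linarith
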